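/- Let $q\in\mathbb C$ with $0<|q|<1$. Write $(x)_n=\prod_{j=1}^{n}(1-xq^{j-1})$ for $n\in\{0,1,2,\dots\}\cup\{\infty\}$, and $(x_1,\dots,x_k)_n=\prod_{j=1}^k(x_j)_n$. For complex parameters let $$ {}_{10}W_9(a;b,c,d,e,f,g,h;q)=\sum_{n=0}^\infty\frac{\left(a,q\sqrt a,-q\sqrt a,b,c,d,e,f,g,h\right)_n}{\left(q,\sqrt a,-\sqrt a,\frac{aq}{b},\frac{aq}{c},\frac{aq}{d},\frac{aq}{e},\frac{aq}{f},\frac{aq}{g},\frac{aq}{h}\right)_n}\,q^n , $$ and, with $b$ as distinguished parameter, let $$ \begin{aligned}\Phi^{(b)}(a;b,c,d,e,f,g,h;q)={}&{}_{10}W_9(a;b,c,d,e,f,g,h;q)\\&+\frac{\left(aq,\frac ba,c,d,e,f,g,h,\frac{bq}{c},\frac{bq}{d},\frac{bq}{e},\frac{bq}{f},\frac{bq}{g},\frac{bq}{h}\right)_\infty}{\left(\frac{b^2q}{a},\frac ab,\frac{aq}{c},\frac{aq}{d},\frac{aq}{e},\frac{aq}{f},\frac{aq}{g},\frac{aq}{h},\frac{bc}{a},\frac{bd}{a},\frac{be}{a},\frac{bf}{a},\frac{bg}{a},\frac{bh}{a}\right)_\infty}\\&\quad\times{}_{10}W_9\!\left(\tfrac{b^2}{a};b,\tfrac{bc}{a},\tfrac{bd}{a},\tfrac{be}{a},\tfrac{bf}{a},\tfrac{bg}{a},\tfrac{bh}{a};q\right).\end{aligned}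 $$ The distinguished parameter may be any one of the seven parameters $b,c,d,e,f,g,h$: interchange the roles of $b$ and that parameter in the formula. Let $\Phi=\Phi(a;b,c,d,e,f,g,h;q)$ denote any one of the seven resulting functions, and, with the same choice of distinguished parameter, put $$\Phi_+(g-)=\Phi(aq^2;bq,cq,dq,eq,fq,g,hq;q),\qquad \Phi_-(g+)=\Phi\!\left(\tfrac{a}{q^2};\tfrac bq,\tfrac cq,\tfrac dq,\tfrac eq,\tfrac fq,g,\tfrac hq;q\right).$$ **Theorem 2.5.** Suppose that $bcdefgh=a^3q^2$, that all the parameters are nonzero, that no denominator vanishes in the definitions of $\Phi$, $\Phi_+(g-)$ and $\Phi_-(g+)$, and that $a\ne q$ and $h\neq gq$. Then, irrespective of the choice of the distinguished parameter, $$ \begin{aligned} &\frac{agq}{h}\,\frac{(1-aq)(1-aq^2)\left(1-\frac{aq}{gb}\right)\left(1-\frac{aq}{gc}\right)\left(1-\frac{aq}{gd}\right)\left(1-\frac{aq}{ge}\right)\left(1-\frac{aq}{gf}\right)}{\left(1-\frac{aq}{g}\right)\left(1-\frac{aq^2}{g}\right)\left(1-\frac{aq}{b}\right)\left(1-\frac{aq}{c}\right)\left(1-\frac{aq}{d}\right)\left(1-\frac{aq}{e}\right)\left(1-\frac{aq}{f}\right)}\\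 &\qquad\times\left(1-\tfrac{gh}{aq}\right)(1-h)(1-b)(1-c)(1-d)(1-e)(1-f)\,\Phi_+(g-)\\ &-\frac{q\left(1-\frac ag\right)\left(1-\frac{aq}{g}\right)\left(1-\frac ah\right)\left(1-\frac{aq}{h}\right)\left(1-\frac ab\right)\left(1-\frac ac\right)\left(1-\frac ad\right)\left(1-\frac ae\right)\left(1-\frac af\right)}{\left(1-\frac aq\right)(1-a)}\,\Phi_-(g+)\\ &-\Bigg[\frac{aq}{h}\left(1-\tfrac hg\right)\left(1-\tfrac{gh}{aq}\right)(1-b)(1-c)(1-d)(1-e)(1-f)\\ &\qquad+\frac{g^2q^2}{h}\,\frac{\left(1-\frac{aq}{g}\right)\left(1-\frac ah\right)\left(1-\frac{aq}{h}\right)\left(1-\frac hq\right)\left(1-\frac{a}{gb}\right)\left(1-\frac{a}{gc}\right)\left(1-\frac{a}{gd}\right)\left(1-\frac{a}{ge}\right)\left(1-\frac{a}{gf}\right)}{\left(1-\frac{gq}{h}\right)\left(1-\frac{a}{gq}\right)}\\ &\qquad-\frac{h(1-g)\left(1-\frac ag\right)\left(1-\frac{aq}{g}\right)\left(1-\frac{aq}{hb}\right)\left(1-\frac{aq}{hc}\right)\left(1-\frac{aq}{hd}\right)\left(1-\frac{aq}{he}\right)\left(1-\frac{aq}{hf}\right)}{1-\frac{gq}{h}}\Bigg]\Phi=0.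 \end{aligned} $$ -/

import Mathlib

/-- The finite `q`-shifted factorial `(a)_n = ∏_{j=1}^{n} (1 - a q^{j-1})`. -/
def qPoch (q a : ℂ) (n : ℕ) : ℂ := ∏ j ∈ Finset.range n, (1 - a * q ^ j)

/-- The infinite `q`-shifted factorial `(a)_∞ = ∏_{j=1}^{∞} (1 - a q^{j-1})`, for `|q| < 1`. -/
noncomputable def qPochInf (q a : ℂ) : ℂ := ∏' j : ℕ, (1 - a * q ^ j)

/-- The basic hypergeometric series `_rφ_s` with base `q`, numerator parameters `num` (so that
`r = num.length`), denominator parameters `den` (so that `s = den.length`) and argument `z`. -/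
noncomputable def basicHyp (q : ℂ) (num den : List ℂ) (z : ℂ) : ℂ :=
  ∑' n : ℕ,
    (num.map fun u => qPoch q u n).prod / ((den.map fun v => qPoch q v n).prod * qPoch q q n)
      * ((-1) ^ n * q ^ (n.choose 2)) ^ (1 + (den.length : ℤ) - (num.length : ℤ)) * z ^ n

/-- Numerator parameters `a, q√a, -q√a, b, …, h` of the very-well-poised `₁₀φ₉`; the seven
parameters `b, c, d, e, f, g, h` are given as `x : Fin 7 → ℂ`. -/
noncomputable def w10Num (q a : ℂ) (x : Fin 7 → ℂ) : List ℂ :=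
  [a, q * a ^ (1 / 2 : ℂ), -(q * a ^ (1 / 2 : ℂ))] ++ List.ofFn x

/-- Denominator parameters `√a, -√a, aq/b, …, aq/h` of the very-well-poised `₁₀φ₉`. -/
noncomputable def w10Den (q a : ℂ) (x : Fin 7 → ℂ) : List ℂ :=
  [a ^ (1 / 2 : ℂ), -(a ^ (1 / 2 : ℂ))] ++ List.ofFn fun i => a * q / x i

/-- The very-well-poised series `₁₀W₉(a; b, c, d, e, f, g, h; q)`, with base and argument `q`.
(It is balanced when `bcdefgh = a³q²`.) -/
noncomputable def W10 (q a : ℂ) (x : Fin 7 → ℂ) : ℂ :=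
  basicHyp q (w10Num q a x) (w10Den q a x) q

/-- The parameters of the complementary series when `x p` is distinguished: for `p` the index
of `b` these are `b, bc/a, bd/a, be/a, bf/a, bg/a, bh/a`. -/
noncomputable def complParams (a : ℂ) (x : Fin 7 → ℂ) (p : Fin 7) : Fin 7 → ℂ :=
  fun i => if i = p then x p else x p * x i / a

/-- The coefficient of the complementary series when `b = x p` is distinguished:
`(aq, b/a, c, …, h, bq/c, …, bq/h)_∞ / (b²q/a, a/b, aq/c, …, aq/h, bc/a, …, bh/a)_∞`. -/
noncomputable def complCoeff (q a : ℂ) (x : Fin 7 → ℂ) (p : Fin 7) : ℂ :=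
  (qPochInf q (a * q) * qPochInf q (x p / a)
      * ∏ i ∈ Finset.univ.erase p, (qPochInf q (x i) * qPochInf q (x p * q / x i)))
    / (qPochInf q (x p ^ 2 * q / a) * qPochInf q (a / x p)
      * ∏ i ∈ Finset.univ.erase p, (qPochInf q (a * q / x i) * qPochInf q (x p * x i / a)))

/-- The complementary pair `Φ = φ + φ'` with parameters `a; x 0, …, x 6` and distinguished
parameter `x p`. -/
noncomputable def Phi (q a : ℂ) (x : Fin 7 → ℂ) (p : Fin 7) : ℂ :=
  W10 q a x + complCoeff q a x p * W10 q (x p ^ 2 / a) (complParams a x p)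

/-- There is no singularity in the definition of `Phi q a x p`: the parameters that occur as
divisors are nonzero, no denominator factor `1 - d q^n` in either series vanishes, and none
vanishes in the infinite products in the denominator of the coefficient. -/
def PhiNonsingular (q a : ℂ) (x : Fin 7 → ℂ) (p : Fin 7) : Prop :=
  a ≠ 0 ∧ (∀ i, x i ≠ 0) ∧
  (∀ d ∈ w10Den q a x, ∀ n : ℕ, d * q ^ n ≠ 1) ∧
  (∀ d ∈ w10Den q (x p ^ 2 / a) (complParams a x p), ∀ n : ℕ, d * q ^ n ≠ 1) ∧
  (∀ n : ℕ, x p ^ 2 * q / a * q ^ n ≠ 1) ∧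
  (∀ n : ℕ, a / x p * q ^ n ≠ 1) ∧
  (∀ i, i ≠ p → ∀ n : ℕ, a * q / x i * q ^ n ≠ 1) ∧
  (∀ i, i ≠ p → ∀ n : ℕ, x p * x i / a * q ^ n ≠ 1)

/-! Put t = q^n. The raised term of index n-1, the unshifted term of index n and the lowered term of
index n+1 have a common factor (`upBase`). Once it and the very-well-poised factor t(1-at²) are
removed, each becomes a quartic in t, and t⁻² times this quartic is invariant under t ↦ 1/(at). Such
quartics form a space of dimension three. An explicit sequence (`upPrimitive`) has, over the same
common factor, a difference P(t) - Q(t) whose two parts of degree eight are exchanged by t ↦ 1/(at)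
up to a power of t. The balancing condition normalises that exchange so that the top coefficients
cancel and P - Q is divisible by t(1-at²), with quotient in the three-dimensional space. Expanding
the quotient in the three quartics gives a telescoping certificate with coefficients α, β, γ
(`certificate_of_esymm`).

Summation does not yet give a homogeneous relation. The primitive tends to a quotient of infinite
products (`vwpLimit`) rather than to zero, so a single series satisfies a relation with a boundary
term (`tsum_principal`).

The complementary series is governed by the same certificate with t replaced by t·x_p/a, hence by
the same α, β, γ. If the distinguished parameter is not g, the shift leaves x_p²/a fixed and moves
two parameters in opposite directions (`tsum_vwpTerm_shiftPair`); if it is g, the whole shift is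
reversed and `tsum_vwpTerm_scaleExcept` applies with raised and lowered series exchanged. The
infinite products in `complCoeff` change under the shift by exactly the rational factors needed, and
`complCoeff_mul_vwpLimit` shows that the two boundary terms are opposite. They cancel in Φ, which
gives `Phi_contiguous`.

It remains to identify the coefficients. They are those of the certificate times
(1-aq/h)/(1-a/(gq)), up to sign; only here does h play a role different from b, …, f. Factors such
as 1 - g/q may vanish, so they are never divided out: the cancelled forms of the certificate are
proved as separate identities. -/

section
open Filter Topology

/-! ### Rational certificates as identities in elementary symmetric polynomials -/

section
variable {K : Type*} [Field K]

/-- The rational certificate: in terms of the elementary symmetric polynomials of the six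
parameters other than `g`, with `E` and `E'` the products of `1 - s * x` and of `1 - s / x`. -/
theorem certificate_of_esymm {a q g t e₁ e₂ e₃ e₄ e₅ e₆ : K} (ha : a ≠ 0) (hq : q ≠ 0) (hg : g ≠ 0)
    (he : e₆ = a ^ 3 * q ^ 2 / g) {S α β γ : K} {E E' : K → K}
    (hE : ∀ s, E s = 1 - e₁ * s + e₂ * s ^ 2 - e₃ * s ^ 3 + e₄ * s ^ 4 - e₅ * s ^ 5 + e₆ * s ^ 6)
    (hE' : ∀ s, E' s
      = (s ^ 6 - e₁ * s ^ 5 + e₂ * s ^ 4 - e₃ * s ^ 3 + e₄ * s ^ 2 - e₅ * s + e₆) / e₆)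
    (hS : S = -q * (1 - g / q) * (1 - a / (g * q)) * (1 - a / g) * (1 - a * q / g))
    (hα : α = -(a ^ 3 * q ^ 3 / g ^ 3) * (1 - a / (g * q)) * E (g / (a * q)))
    (hβ : β = -q ^ 2 * (1 - a * q / g) * E (1 / q))
    (hγ : γ = -α - β + a * S * (e₅ / e₆ - e₁ / a - g / (a * q) - 1 / q + q / a + q / g)) :
    S * (E (t / a) * (1 - t * g / (a * q)) * (1 - t / q)
        - E' t * (1 - q * t / a) * (1 - t * q / g))
      = t / a * (1 - t ^ 2 / a)
        * (α * ((1 - t / a) * (1 - t) * (1 - q * t / a) * (1 - t / q))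
          + β * ((1 - t / g) * (1 - t * g / a) * (1 - t * q / g) * (1 - t * g / (a * q)))
          + γ * ((1 - t * q / g) * (1 - t * g / (a * q)) * (1 - q * t / a) * (1 - t / q))) := by
  -- The coefficients are forced. At t = g/q only the α-term survives on the right, at t = a/q only
  -- the β-term, and comparing the coefficients of t gives γ. The factor `S` clears the denominators
  -- that arise.
  subst hγ hβ hα hS
  simp only [hE, hE']
  subst he
  field_simp
  ring
-- This is the certificate at t = a, the initial point of the principal series, with the common
-- factor 1 - g/q cancelled. The α-term drops out because of its factor 1 - t/a. It is proved
-- separately since g = q is not excluded.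
theorem certificate_of_esymm_at_a {a q g e₁ e₂ e₃ e₄ e₅ e₆ : K} (ha : a ≠ 0) (hq : q ≠ 0) (hg : g ≠ 0)
    (he : e₆ = a ^ 3 * q ^ 2 / g) {S α β γ : K} {E E' : K → K}
    (hE : ∀ s, E s = 1 - e₁ * s + e₂ * s ^ 2 - e₃ * s ^ 3 + e₄ * s ^ 4 - e₅ * s ^ 5 + e₆ * s ^ 6)
    (hE' : ∀ s, E' s
      = (s ^ 6 - e₁ * s ^ 5 + e₂ * s ^ 4 - e₃ * s ^ 3 + e₄ * s ^ 2 - e₅ * s + e₆) / e₆)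
    (hS : S = -q * (1 - a / (g * q)) * (1 - a / g) * (1 - a * q / g))
    (hα : α = -(a ^ 3 * q ^ 3 / g ^ 3) * (1 - a / (g * q)) * E (g / (a * q)))
    (hβ : β = -q ^ 2 * (1 - a * q / g) * E (1 / q))
    (hγ : γ = -α - β + a * (S * (1 - g / q))
      * (e₅ / e₆ - e₁ / a - g / (a * q) - 1 / q + q / a + q / g)) :
    S * (E 1 * (1 - g / q) * (1 - a / q)
        - E' a * (1 - q) * (1 - a * q / g))
      = (1 - a)
        * (β * ((1 - a / g) * (1 - g) * (1 - a * q / g))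
          + γ * ((1 - a * q / g) * (1 - q) * (1 - a / q))) := by
  subst hγ hβ hα hS
  simp only [hE, hE']
  subst he
  field_simp
  ring

/-- This is the certificate at t = g, again with 1 - g/q cancelled; there the β-term vanishes. It
serves the initial term of the complementary series when g is distinguished. -/
theorem certificate_of_esymm_at_g {a q g e₁ e₂ e₃ e₄ e₅ e₆ : K} (ha : a ≠ 0) (hq : q ≠ 0) (hg : g ≠ 0)
    (he : e₆ = a ^ 3 * q ^ 2 / g) {S α β γ : K} {E E' : K → K}
    (hE : ∀ s, E s = 1 - e₁ * s + e₂ * s ^ 2 - e₃ * s ^ 3 + e₄ * s ^ 4 - e₅ * s ^ 5 + e₆ * s ^ 6)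
    (hE' : ∀ s, E' s
      = (s ^ 6 - e₁ * s ^ 5 + e₂ * s ^ 4 - e₃ * s ^ 3 + e₄ * s ^ 2 - e₅ * s + e₆) / e₆)
    (hS : S = -q * (1 - a / (g * q)) * (1 - a / g) * (1 - a * q / g))
    (hα : α = -(a ^ 3 * q ^ 3 / g ^ 3) * (1 - a / (g * q)) * E (g / (a * q)))
    (hβ : β = -q ^ 2 * (1 - a * q / g) * E (1 / q))
    (hγ : γ = -α - β + a * (S * (1 - g / q))
      * (e₅ / e₆ - e₁ / a - g / (a * q) - 1 / q + q / a + q / g)) :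
    S * (E (g / a) * (1 - g / q) * (1 - g ^ 2 / (a * q))
        - E' g * (1 - q) * (1 - g * q / a))
      = g / a * (1 - g ^ 2 / a)
        * (α * ((1 - g / a) * (1 - g) * (1 - g * q / a))
          + γ * ((1 - g * q / a) * (1 - q) * (1 - g ^ 2 / (a * q)))) := by
  subst hγ hβ hα hS
  simp only [hE, hE']
  subst he
  field_simp
  ring

/-- This is the certificate at t = b, where b is one of the six parameters, so that the product with
reciprocals vanishes. The factors 1 - b/q and 1 - b²/a are cancelled, and the symmetric polynomials
are those of the remaining five parameters. It serves the initial term of the complementary series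
when b is distinguished. -/
theorem certificate_of_esymm_at_b {a q g b e₁ e₂ e₃ e₄ e₅ : K} (ha : a ≠ 0) (hq : q ≠ 0) (hg : g ≠ 0)
    (hb : b ≠ 0)
    (he : e₅ = a ^ 3 * q ^ 2 / (g * b)) {S α β γ : K} {E : K → K}
    (hE : ∀ s, E s = 1 - e₁ * s + e₂ * s ^ 2 - e₃ * s ^ 3 + e₄ * s ^ 4 - e₅ * s ^ 5)
    (hS : S = -q * (1 - g / q) * (1 - a / (g * q)) * (1 - a / g) * (1 - a * q / g))
    (hα : α = -(a ^ 3 * q ^ 3 / g ^ 3) * (1 - a / (g * q)) * E (g / (a * q))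
      * (1 - g * b / (a * q)))
    (hβ : β = -q ^ 2 * (1 - a * q / g) * E (1 / q))
    (hγ : γ = -α - β * (1 - b / q) + a * S
      * (e₄ / e₅ + 1 / b - (e₁ + b) / a - g / (a * q) - 1 / q + q / a + q / g)) :
    S * (E (b / a) * (1 - b * g / (a * q)))
      = b / a
        * (α * ((1 - b / a) * (1 - b) * (1 - q * b / a))
          + β * ((1 - b / g) * (1 - b * g / a) * (1 - b * q / g) * (1 - b * g / (a * q)))
          + γ * ((1 - b * q / g) * (1 - b * g / (a * q)) * (1 - q * b / a))) := by
  subst hγ hβ hα hS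
  simp only [hE]
  subst he
  field_simp
  ring

/-- γ is symmetric in the six parameters other than g, whereas the bracket in the theorem singles
out h. Expressing both through the five remaining parameters, with `e₅` eliminated by balancing,
turns their agreement into a polynomial identity. -/
theorem middle_coeff_of_esymm {a q g h e₁ e₂ e₃ e₄ e₅ : K} (ha : a ≠ 0) (hq : q ≠ 0) (hg : g ≠ 0)
    (hh : h ≠ 0) (hgh : h - g * q ≠ 0) (hag : g * q - a ≠ 0)
    (he : e₅ = a ^ 3 * q ^ 2 / (g * h)) {S α β γ : K} {E E' : K → K}
    (hE : ∀ s, E s = 1 - e₁ * s + e₂ * s ^ 2 - e₃ * s ^ 3 + e₄ * s ^ 4 - e₅ * s ^ 5)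
    (hE' : ∀ s, E' s = -(s ^ 5 - e₁ * s ^ 4 + e₂ * s ^ 3 - e₃ * s ^ 2 + e₄ * s - e₅) / e₅)
    (hS : S = -q * (1 - g / q) * (1 - a / (g * q)) * (1 - a / g) * (1 - a * q / g))
    (hα : α = -(a ^ 3 * q ^ 3 / g ^ 3) * (1 - a / (g * q)) * E (g / (a * q))
      * (1 - g * h / (a * q)))
    (hβ : β = -q ^ 2 * (1 - a * q / g) * E (1 / q) * (1 - h / q))
    (hγ : γ = -α - β + a * S
      * (e₄ / e₅ + 1 / h - (e₁ + h) / a - g / (a * q) - 1 / q + q / a + q / g)) :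
    (a * q / h * (1 - h / g) * (1 - g * h / (a * q)) * E 1
          + g ^ 2 * q ^ 2 / h
            * (((1 - a * q / g) * (1 - a / h) * (1 - a * q / h) * (1 - h / q) * E' (a / g))
              / ((1 - g * q / h) * (1 - a / (g * q))))
          - (h * (1 - g) * (1 - a / g) * (1 - a * q / g) * E' (a * q / h))
            / (1 - g * q / h)) * (1 - a / (g * q)) = - (1 - a * q / h) * γ := by
  have h1 : 1 - g * q / h ≠ 0 := by
    rw [one_sub_div hh]; exact div_ne_zero hgh hh
  have h2 : 1 - a / (g * q) ≠ 0 := by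
    rw [one_sub_div (mul_ne_zero hg hq)]; exact div_ne_zero hag (mul_ne_zero hg hq)
  -- Only the two denominators that are not monomials are cleared here; the other divisions are by
  -- monomials and are left to `field_simp`.
  have key : ∀ X U Y Z d₁ d₂ R : K, d₁ ≠ 0 → d₂ ≠ 0 → X * d₁ * d₂ + U * Y - Z * d₂ = R * d₁ →
      (X + U * (Y / (d₁ * d₂)) - Z / d₁) * d₂ = R := by
    intro X U Y Z d₁ d₂ R h₁ h₂ H
    field_simp
    linear_combination H
  apply key _ _ _ _ _ _ _ h1 h2
  subst hγ hβ hα hS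
  simp only [hE, hE']
  subst he
  clear h1 h2 hgh hag key
  field_simp
  ring
end

/-! ### Finite and infinite q-shifted factorials -/

theorem qPoch_zero (q a : ℂ) : qPoch q a 0 = 1 := by simp [qPoch]

theorem qPoch_succ (q a : ℂ) (n : ℕ) : qPoch q a (n + 1) = qPoch q a n * (1 - a * q ^ n) := by
  simp [qPoch, Finset.prod_range_succ]

theorem qPoch_succ' (q a : ℂ) (n : ℕ) : qPoch q a (n + 1) = (1 - a) * qPoch q (a * q) n := by
  simp only [qPoch, Finset.prod_range_succ', pow_zero, mul_one, pow_succ']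
  rw [mul_comm]
  simp only [mul_assoc]

theorem qPoch_ne_zero {q a : ℂ} (h : ∀ n : ℕ, a * q ^ n ≠ 1) (n : ℕ) : qPoch q a n ≠ 0 :=
  Finset.prod_ne_zero_iff.2 fun j _ => sub_ne_zero.2 (h j).symm

theorem summable_norm_mul_pow {q : ℂ} (hq : ‖q‖ < 1) (a : ℂ) :
    Summable fun j : ℕ => ‖-(a * q ^ j)‖ := by
  simp only [norm_neg, norm_mul, norm_pow]
  exact (summable_geometric_of_lt_one (norm_nonneg q) hq).mul_left _

theorem multipliable_qPoch {q : ℂ} (hq : ‖q‖ < 1) (a : ℂ) :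
    Multipliable fun j : ℕ => 1 - a * q ^ j := by
  simpa [sub_eq_add_neg] using multipliable_one_add_of_summable (summable_norm_mul_pow hq a)

theorem tendsto_qPoch {q : ℂ} (hq : ‖q‖ < 1) (a : ℂ) :
    Tendsto (qPoch q a) atTop (𝓝 (qPochInf q a)) :=
  (multipliable_qPoch hq a).hasProd.tendsto_prod_nat

theorem qPochInf_ne_zero {q a : ℂ} (hq : ‖q‖ < 1) (h : ∀ n : ℕ, a * q ^ n ≠ 1) :
    qPochInf q a ≠ 0 := by
  have := tprod_one_add_ne_zero_of_summable (f := fun n : ℕ => -(a * q ^ n))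
    (fun n => by simpa [← sub_eq_add_neg] using sub_ne_zero.2 (h n).symm)
    (summable_norm_mul_pow hq a)
  simpa [qPochInf, sub_eq_add_neg] using this

theorem qPochInf_eq {q : ℂ} (hq : ‖q‖ < 1) (a : ℂ) :
    qPochInf q a = (1 - a) * qPochInf q (a * q) := by
  refine tendsto_nhds_unique ((tendsto_qPoch hq a).comp (tendsto_add_atTop_nat 1)) ?_
  simpa only [Function.comp_def, qPoch_succ'] using (tendsto_qPoch hq (a * q)).const_mul (1 - a)

theorem pow_succ_ne_one_of_norm_lt_one {q : ℂ} (hq : ‖q‖ < 1) (n : ℕ) : q * q ^ n ≠ 1 := by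
  intro h
  have h1 : ‖q ^ (n + 1)‖ < 1 := by
    rw [norm_pow]; exact pow_lt_one₀ (norm_nonneg q) hq (Nat.succ_ne_zero n)
  rw [pow_succ', h, norm_one] at h1
  exact lt_irrefl _ h1

/-! ### Very-well-poised series without square roots -/

/-- The general term of the very-well-poised series with parameters `x i`, and argument `q`,
in a form free of square roots. -/
noncomputable def vwpTerm (q A : ℂ) (x : Fin 7 → ℂ) (n : ℕ) : ℂ :=
  qPoch q A n * (∏ i, qPoch q (x i) n) * (1 - A * (q ^ n) ^ 2)
    / ((1 - A) * qPoch q q n * ∏ i, qPoch q (A * q / x i) n) * q ^ n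

/-- No denominator factor of the very-well-poised series vanishes. -/
def VwpRegular (q A : ℂ) (x : Fin 7 → ℂ) : Prop :=
  (∀ n : ℕ, A * (q ^ n) ^ 2 ≠ 1) ∧ ∀ i, ∀ n : ℕ, A * q / x i * q ^ n ≠ 1

theorem VwpRegular.of_w10Den {q A : ℂ} {x : Fin 7 → ℂ}
    (h : ∀ d ∈ w10Den q A x, ∀ n : ℕ, d * q ^ n ≠ 1) : VwpRegular q A x := by
  have hA : A = A ^ (1 / 2 : ℂ) * A ^ (1 / 2 : ℂ) := by
    rw [← sq, ← Complex.cpow_nat_mul]; norm_num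
  constructor
  · intro n hn
    have h1 := h (A ^ (1 / 2 : ℂ)) (by simp [w10Den]) n
    have h2 := h (-(A ^ (1 / 2 : ℂ))) (by simp [w10Den]) n
    have : (A ^ (1 / 2 : ℂ) * q ^ n) ^ 2 = 1 := by
      rw [mul_pow, sq (A ^ (1 / 2 : ℂ)), ← hA, hn]
    rcases mul_self_eq_one_iff.1 ((sq _).symm.trans this) with h3 | h3
    · exact h1 h3
    · exact h2 (by rw [neg_mul, h3, neg_neg])
  · intro i
    exact h _ (by simp only [w10Den, List.mem_append, List.mem_ofFn]; exact Or.inr ⟨i, rfl⟩)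

theorem W10_eq_tsum {q A : ℂ} {x : Fin 7 → ℂ}
    (h : ∀ d ∈ w10Den q A x, ∀ n : ℕ, d * q ^ n ≠ 1) :
    W10 q A x = ∑' n, vwpTerm q A x n := by
  have hA : A = A ^ (1 / 2 : ℂ) * A ^ (1 / 2 : ℂ) := by
    rw [← sq, ← Complex.cpow_nat_mul]; norm_num
  have h1 := h (A ^ (1 / 2 : ℂ)) (by simp [w10Den])
  have h2 := h (-(A ^ (1 / 2 : ℂ))) (by simp [w10Den])
  unfold W10 basicHyp
  refine tsum_congr fun n => ?_
  have hlen : (1 + ((w10Den q A x).length : ℤ) - ((w10Num q A x).length : ℤ)) = 0 := by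
    simp [w10Den, w10Num]
  rw [hlen, zpow_zero, mul_one, vwpTerm]
  congr 1
  set r := A ^ (1 / 2 : ℂ)
  have e1 : ∀ s : ℂ, (1 - s) * qPoch q (q * s) n = qPoch q s n * (1 - s * q ^ n) := fun s => by
    rw [mul_comm q s, ← qPoch_succ', qPoch_succ]
  -- The factors for √A and -√A combine by difference of squares, so only A = (√A)² enters and the
  -- choice of root is immaterial.
  have e3 : (1 - A) * (qPoch q (q * r) n * qPoch q (-(q * r)) n)
      = qPoch q r n * qPoch q (-r) n * (1 - A * (q ^ n) ^ 2) := by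
    have := e1 r
    have h4 := e1 (-r)
    rw [mul_neg] at h4
    rw [hA]
    linear_combination (1 + r) * qPoch q (-(q * r)) n * this + qPoch q r n * (1 - r * q ^ n) * h4
  have hnum : ((w10Num q A x).map fun u => qPoch q u n).prod
      = qPoch q A n * (qPoch q (q * r) n * qPoch q (-(q * r)) n) * ∏ i, qPoch q (x i) n := by
    simp only [w10Num, List.map_append, List.prod_append, List.map_cons, List.map_nil,
      List.prod_cons, List.prod_nil, List.map_ofFn, List.prod_ofFn, Function.comp_def]
    ring
  have hden : ((w10Den q A x).map fun u => qPoch q u n).prod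
      = (qPoch q r n * qPoch q (-r) n) * ∏ i, qPoch q (A * q / x i) n := by
    simp only [w10Den, List.map_append, List.prod_append, List.map_cons, List.map_nil,
      List.prod_cons, List.prod_nil, List.map_ofFn, List.prod_ofFn, Function.comp_def]
    ring
  have hA1 : 1 - A ≠ 0 := by
    have := (VwpRegular.of_w10Den h).1 0
    simpa using sub_ne_zero.2 this.symm
  have hr := mul_ne_zero (qPoch_ne_zero h1 n) (qPoch_ne_zero h2 n)
  rw [hnum, hden]
  rw [show qPoch q (q * r) n * qPoch q (-(q * r)) n
    = qPoch q r n * qPoch q (-r) n * (1 - A * (q ^ n) ^ 2) / (1 - A) by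
      rw [← e3]; field_simp]
  generalize qPoch q r n * qPoch q (-r) n = R at *
  generalize qPoch q q n = Q
  generalize ∏ i, qPoch q (A * q / x i) n = D
  field_simp

/-- The limit of `vwpTerm q A x n / q ^ n`. -/
noncomputable def vwpLimit (q A : ℂ) (x : Fin 7 → ℂ) : ℂ :=
  qPochInf q (A * q) * (∏ i, qPochInf q (x i))
    / (qPochInf q q * ∏ i, qPochInf q (A * q / x i))

theorem VwpRegular.one_sub_ne_zero {q A : ℂ} {x : Fin 7 → ℂ} (h : VwpRegular q A x) :
    1 - A ≠ 0 := by
  simpa using sub_ne_zero.2 (h.1 0).symm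

/-- Apart from the factor `q ^ n`, the term converges, hence is bounded, and a geometric series
dominates. -/
theorem summable_vwpTerm {q A : ℂ} {x : Fin 7 → ℂ} (hq : ‖q‖ < 1) (h : VwpRegular q A x) :
    Summable (vwpTerm q A x) := by
  have hlim : Tendsto (fun n => qPoch q A n * (∏ i, qPoch q (x i) n) * (1 - A * (q ^ n) ^ 2)
    / ((1 - A) * qPoch q q n * ∏ i, qPoch q (A * q / x i) n)) atTop
    (𝓝 (qPochInf q A * (∏ i, qPochInf q (x i)) * (1 - A * 0 ^ 2)
    / ((1 - A) * qPochInf q q * ∏ i, qPochInf q (A * q / x i)))) := by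
    refine Tendsto.div (((tendsto_qPoch hq A).mul
      (tendsto_finsetProd _ fun i _ => tendsto_qPoch hq (x i))).mul
      (tendsto_const_nhds.sub (((tendsto_pow_atTop_nhds_zero_of_norm_lt_one hq).pow 2).const_mul A)))
      (((tendsto_qPoch hq q).const_mul _).mul
        (tendsto_finsetProd _ fun i _ => tendsto_qPoch hq (A * q / x i))) ?_
    exact mul_ne_zero (mul_ne_zero h.one_sub_ne_zero
      (qPochInf_ne_zero hq (pow_succ_ne_one_of_norm_lt_one hq)))
      (Finset.prod_ne_zero_iff.2 fun i _ => qPochInf_ne_zero hq (h.2 i))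
  obtain ⟨C, hC⟩ := hlim.norm.bddAbove_range
  refine Summable.of_norm_bounded (g := fun n => C * ‖q‖ ^ n)
    ((summable_geometric_of_lt_one (norm_nonneg q) hq).mul_left C) fun n => ?_
  rw [vwpTerm, norm_mul, norm_pow]
  exact mul_le_mul_of_nonneg_right (hC ⟨n, rfl⟩) (pow_nonneg (norm_nonneg q) n)

/-! ### Contiguous relation shifting `A` and all parameters but one -/

/-- Multiply the parameters `x i`, `i ≠ j`, by `r`, and leave `x j` as it is. -/
def scaleExcept (r : ℂ) (x : Fin 7 → ℂ) (j : Fin 7) : Fin 7 → ℂ :=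
  fun i => if i = j then x j else x i * r

theorem prod_eq_mul_erase (j : Fin 7) (f : Fin 7 → ℂ) :
    ∏ i, f i = f j * ∏ i ∈ Finset.univ.erase j, f i :=
  (Finset.mul_prod_erase _ _ (Finset.mem_univ j)).symm

theorem prod_one_sub_mul_prod_qPoch (q : ℂ) (s : Finset (Fin 7)) (y : Fin 7 → ℂ) (n : ℕ) :
    (∏ i ∈ s, (1 - y i)) * ∏ i ∈ s, qPoch q (y i * q) n = ∏ i ∈ s, qPoch q (y i) (n + 1) := by
  rw [← Finset.prod_mul_distrib]
  exact Finset.prod_congr rfl fun i _ => (qPoch_succ' q (y i) n).symm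

theorem prod_qPoch_succ (q : ℂ) (s : Finset (Fin 7)) (y : Fin 7 → ℂ) (n : ℕ) :
    ∏ i ∈ s, qPoch q (y i) (n + 1)
      = (∏ i ∈ s, qPoch q (y i) n) * ∏ i ∈ s, (1 - y i * q ^ n) := by
  rw [← Finset.prod_mul_distrib]
  exact Finset.prod_congr rfl fun i _ => qPoch_succ q (y i) n

theorem vwpTerm_eq_erase (q A : ℂ) (x : Fin 7 → ℂ) (j : Fin 7) (n : ℕ) :
    vwpTerm q A x n = qPoch q A n * (qPoch q (x j) n * ∏ i ∈ Finset.univ.erase j, qPoch q (x i) n)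
        * (1 - A * (q ^ n) ^ 2)
      / ((1 - A) * qPoch q q n * (qPoch q (A * q / x j) n
        * ∏ i ∈ Finset.univ.erase j, qPoch q (A * q / x i) n)) * q ^ n := by
  rw [vwpTerm, prod_eq_mul_erase j, prod_eq_mul_erase j]

theorem prod_erase_scaleExcept (r : ℂ) (x : Fin 7 → ℂ) (j : Fin 7) (f : ℂ → ℂ) :
    ∏ i ∈ Finset.univ.erase j, f (scaleExcept r x j i) = ∏ i ∈ Finset.univ.erase j, f (x i * r) :=
  Finset.prod_congr rfl fun i hi => by
    rw [scaleExcept, if_neg (Finset.ne_of_mem_erase hi)]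

theorem scaleExcept_self (r : ℂ) (x : Fin 7 → ℂ) (j : Fin 7) : scaleExcept r x j j = x j := by
  simp [scaleExcept]

/-- The common factor of the terms of the contiguous relation. -/
noncomputable def upBase (q A : ℂ) (x : Fin 7 → ℂ) (j : Fin 7) (k : ℕ) : ℂ :=
  qPoch q A k * qPoch q (x j) k * (∏ i ∈ Finset.univ.erase j, qPoch q (x i) (k + 1))
    / ((1 - A) * qPoch q q (k + 2) * qPoch q (A * q / x j) (k + 2)
      * ∏ i ∈ Finset.univ.erase j, qPoch q (A * q / x i) (k + 1))

section
variable {q A : ℂ} {x : Fin 7 → ℂ} {j : Fin 7}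

theorem one_sub_mul_pow_ne_zero {q a : ℂ} (h : ∀ n : ℕ, a * q ^ n ≠ 1) (n : ℕ) :
    1 - a * q ^ n ≠ 0 := sub_ne_zero.2 (h n).symm

/-- Together with the two lemmas on `upFactor` and `downFactor`, this writes the terms of index k+1
(unshifted), k (raised) and k+2 (lowered) over one base. At these indices all three have the same
very-well-poised factor 1 - At², with t = q^(k+1), since A is multiplied by q² or q⁻². What remains
is a quartic in t. -/
theorem vwpTerm_eq_upBase (hq0 : q ≠ 0) (hq : ‖q‖ < 1) (h : VwpRegular q A x) (k : ℕ) :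
    vwpTerm q A x (k + 1) = upBase q A x j k * q ^ (k + 1)
      * ((1 - A * (q ^ (k + 1)) ^ 2) * ((1 - q ^ (k + 1) * x j / q)
        * (1 - q ^ (k + 1) * A / q) * (1 - q ^ (k + 1) * q)
        * (1 - q ^ (k + 1) * (A * q / x j)))) := by
  have hQ := pow_succ_ne_one_of_norm_lt_one hq
  have h1 := h.one_sub_ne_zero
  have h2 := qPoch_ne_zero hQ (k + 1)
  have h3 := one_sub_mul_pow_ne_zero hQ (k + 1)
  have h4 := qPoch_ne_zero (h.2 j) (k + 1)
  have h5 := one_sub_mul_pow_ne_zero (h.2 j) (k + 1)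
  have h6 : ∏ i ∈ Finset.univ.erase j, qPoch q (A * q / x i) (k + 1) ≠ 0 :=
    Finset.prod_ne_zero_iff.2 fun i _ => qPoch_ne_zero (h.2 i) (k + 1)
  have e1 : 1 - q ^ (k + 1) * A / q = 1 - A * q ^ k := by field_simp; ring
  have e2 : 1 - q ^ (k + 1) * x j / q = 1 - x j * q ^ k := by field_simp; ring
  rw [vwpTerm_eq_erase q A x j, upBase, qPoch_succ q q (k + 1), qPoch_succ q _ (k + 1), e1, e2,
    qPoch_succ q A, qPoch_succ q (x j)]
  rw [mul_comm (q ^ (k + 1)) q, mul_comm (q ^ (k + 1)) (A * q / x j)]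
  generalize ∏ i ∈ Finset.univ.erase j, qPoch q (A * q / x i) (k + 1) = D at *
  generalize ∏ i ∈ Finset.univ.erase j, qPoch q (x i) (k + 1) = N
  generalize qPoch q (A * q / x j) (k + 1) = V at *
  generalize 1 - A * q / x j * q ^ (k + 1) = v at *
  generalize 1 - q * q ^ (k + 1) = u at *
  generalize qPoch q q (k + 1) = U at *
  generalize 1 - A * (q ^ (k + 1)) ^ 2 = y
  field_simp

/-- The factor relating the coefficient of the series with raised parameters to the
certificate. -/
noncomputable def upFactor (q A : ℂ) (x : Fin 7 → ℂ) (j : Fin 7) : ℂ :=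
  q * ((1 - A * q) * (1 - A * q ^ 2) * ∏ i ∈ Finset.univ.erase j, (1 - x i))
    / ((1 - A * q / x j) * (1 - A * q ^ 2 / x j) * ∏ i ∈ Finset.univ.erase j, (1 - A * q / x i))

/-- The factor relating the coefficient of the series with lowered parameters to the
certificate. -/
noncomputable def downFactor (q A : ℂ) (x : Fin 7 → ℂ) (j : Fin 7) : ℂ :=
  ((1 - A / (q * x j)) * (1 - A / x j) * ∏ i ∈ Finset.univ.erase j, (1 - A / x i))
    / (q * (1 - A) * (1 - A / q))

theorem upFactor_mul_vwpTerm (hq0 : q ≠ 0) (hq : ‖q‖ < 1) (h : VwpRegular q A x)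
    (hx : ∀ i, x i ≠ 0)
    (hp : VwpRegular q (A * q ^ 2) (scaleExcept q x j)) (k : ℕ) :
    upFactor q A x j * vwpTerm q (A * q ^ 2) (scaleExcept q x j) k
      = upBase q A x j k * q ^ (k + 1) * ((1 - A * (q ^ (k + 1)) ^ 2)
        * ((1 - q ^ (k + 1)) * (1 - q ^ (k + 1) * A) * (1 - q ^ (k + 1) * q)
          * (1 - q ^ (k + 1) * A / q))) := by
  have hQ := pow_succ_ne_one_of_norm_lt_one hq
  have h1 := h.one_sub_ne_zero
  have h1' := hp.one_sub_ne_zero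
  have h2 := qPoch_ne_zero hQ k
  have h3 := one_sub_mul_pow_ne_zero hQ (k + 1)
  have h3' := one_sub_mul_pow_ne_zero hQ k
  have h4 := qPoch_ne_zero (h.2 j) (k + 2)
  have h6 : ∏ i ∈ Finset.univ.erase j, qPoch q (A * q / x i) (k + 1) ≠ 0 :=
    Finset.prod_ne_zero_iff.2 fun i _ => qPoch_ne_zero (h.2 i) (k + 1)
  have e1 : 1 - q ^ (k + 1) * A / q = 1 - A * q ^ k := by field_simp; ring
  have a1 : (1 - A) * (1 - A * q) * qPoch q (A * q ^ 2) k
      = qPoch q A k * (1 - A * q ^ k) * (1 - A * q ^ (k + 1)) := by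
    rw [← qPoch_succ, ← qPoch_succ, qPoch_succ', qPoch_succ']
    ring_nf
  have a2 := prod_one_sub_mul_prod_qPoch q (Finset.univ.erase j) x k
  have a3 := prod_one_sub_mul_prod_qPoch q (Finset.univ.erase j) (fun i => A * q / x i) k
  have a4 : (1 - A * q / x j) * (1 - A * q ^ 2 / x j) * qPoch q (A * q ^ 2 * q / x j) k
      = qPoch q (A * q / x j) (k + 2) := by
    rw [qPoch_succ', qPoch_succ']
    ring_nf
  rw [vwpTerm_eq_erase _ _ _ j, upBase, scaleExcept_self,
    prod_erase_scaleExcept q x j fun y => qPoch q y k,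
    prod_erase_scaleExcept q x j fun y => qPoch q (A * q ^ 2 * q / y) k, upFactor,
    Finset.prod_congr rfl fun i _ => show qPoch q (A * q ^ 2 * q / (x i * q)) k
      = qPoch q (A * q / x i * q) k by
        congr 1; have := hx i; field_simp]
  rw [← a4] at h4 ⊢
  rw [← a3] at h6 ⊢
  rw [← a2, qPoch_succ q q (k + 1), qPoch_succ q q k, e1]
  generalize ∏ i ∈ Finset.univ.erase j, qPoch q (A * q / x i * q) k = D at *
  generalize ∏ i ∈ Finset.univ.erase j, (1 - A * q / x i) = D' at *
  generalize ∏ i ∈ Finset.univ.erase j, qPoch q (x i * q) k = N at *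
  generalize ∏ i ∈ Finset.univ.erase j, (1 - x i) = N' at *
  generalize qPoch q (A * q ^ 2 * q / x j) k = V at *
  generalize 1 - A * q / x j = v at *
  generalize 1 - A * q ^ 2 / x j = v' at *
  rw [show q ^ (k + 1) * q = q * q ^ (k + 1) by ring,
    show 1 - q ^ (k + 1) = 1 - q * q ^ k by ring,
    show 1 - q ^ (k + 1) * A = 1 - A * q ^ (k + 1) by ring,
    show 1 - A * q ^ 2 * (q ^ k) ^ 2 = 1 - A * (q ^ (k + 1)) ^ 2 by ring]
  generalize hu : 1 - q * q ^ (k + 1) = u at *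
  generalize 1 - q * q ^ k = u' at *
  generalize qPoch q q k = U at *
  generalize 1 - A * (q ^ (k + 1)) ^ 2 = y
  generalize 1 - A * q ^ (k + 1) = y1 at *
  generalize 1 - A * q ^ k = y2 at *
  generalize qPoch q (A * q ^ 2) k = P at *
  generalize qPoch q A k = P' at *
  generalize qPoch q (x j) k = W at *
  clear hu a2 a3 a4
  generalize 1 - A * q ^ 2 = r at *
  generalize 1 - A = r0 at *
  have hD : D ≠ 0 := right_ne_zero_of_mul h6
  have hD' : D' ≠ 0 := left_ne_zero_of_mul h6
  have hV : V ≠ 0 := right_ne_zero_of_mul h4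
  have hv : v ≠ 0 := left_ne_zero_of_mul (left_ne_zero_of_mul h4)
  have hv' : v' ≠ 0 := right_ne_zero_of_mul (left_ne_zero_of_mul h4)
  field_simp
  linear_combination q * q ^ k * N' * W * N * y * a1

/-- The product of the `1 - x i / q` arises because each lowered factorial starts one factor
earlier. It stays on the right instead of being divided into `downFactor`, as it may vanish. -/
theorem downFactor_mul_vwpTerm (hq0 : q ≠ 0) (hq : ‖q‖ < 1) (h : VwpRegular q A x)
    (hx : ∀ i, x i ≠ 0) (hAq : 1 - A / q ≠ 0)
    (hp : VwpRegular q (A * (q⁻¹) ^ 2) (scaleExcept q⁻¹ x j)) (k : ℕ) :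
    downFactor q A x j * vwpTerm q (A * (q⁻¹) ^ 2) (scaleExcept q⁻¹ x j) (k + 2)
      = upBase q A x j k * q ^ (k + 1) * ((1 - A * (q ^ (k + 1)) ^ 2)
        * ((∏ i ∈ Finset.univ.erase j, (1 - x i / q)) * ((1 - q ^ (k + 1) * A / x j)
          * (1 - q ^ (k + 1) * x j) * (1 - q ^ (k + 1) * (A * q / x j))
          * (1 - q ^ (k + 1) * x j / q)))) := by
  have hQ := pow_succ_ne_one_of_norm_lt_one hq
  have h1 := h.one_sub_ne_zero
  have h1' := hp.one_sub_ne_zero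
  have h2 := qPoch_ne_zero hQ (k + 2)
  have h4 := qPoch_ne_zero (h.2 j) k
  have h4' := one_sub_mul_pow_ne_zero (h.2 j) k
  have h4'' := one_sub_mul_pow_ne_zero (h.2 j) (k + 1)
  have h6 : ∏ i ∈ Finset.univ.erase j, qPoch q (A * q / x i) (k + 1) ≠ 0 :=
    Finset.prod_ne_zero_iff.2 fun i _ => qPoch_ne_zero (h.2 i) (k + 1)
  have h7 : ∏ i ∈ Finset.univ.erase j, qPoch q (A / x i) (k + 2) ≠ 0 :=
    Finset.prod_ne_zero_iff.2 fun i hi => by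
      convert qPoch_ne_zero (hp.2 i) (k + 2) using 2
      rw [scaleExcept, if_neg (Finset.ne_of_mem_erase hi)]; have := hx i; field_simp
  have h8 : qPoch q (A / (q * x j)) (k + 2) ≠ 0 := by
    convert qPoch_ne_zero (hp.2 j) (k + 2) using 2
    rw [scaleExcept_self]; have := hx j; field_simp
  have e2 : 1 - q ^ (k + 1) * x j / q = 1 - x j * q ^ k := by field_simp; ring
  have a1 : qPoch q (A * q⁻¹ ^ 2) (k + 2) = (1 - A * q⁻¹ ^ 2) * (1 - A / q) * qPoch q A k := by
    rw [qPoch_succ', qPoch_succ', ← mul_assoc]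
    congr 2 <;> field_simp
  have a2 : ∏ i ∈ Finset.univ.erase j, qPoch q (x i * q⁻¹) (k + 2)
      = (∏ i ∈ Finset.univ.erase j, (1 - x i / q))
        * ∏ i ∈ Finset.univ.erase j, qPoch q (x i) (k + 1) := by
    rw [← prod_one_sub_mul_prod_qPoch]
    congr 1
    refine Finset.prod_congr rfl fun i _ => ?_
    congr 1; field_simp
  have a3 : ∏ i ∈ Finset.univ.erase j, qPoch q (A / x i) (k + 2)
      = (∏ i ∈ Finset.univ.erase j, (1 - A / x i))
        * ∏ i ∈ Finset.univ.erase j, qPoch q (A * q / x i) (k + 1) := by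
    rw [← prod_one_sub_mul_prod_qPoch]
    congr 1
    refine Finset.prod_congr rfl fun i _ => ?_
    congr 1; ring
  have a4 : qPoch q (A / (q * x j)) (k + 2)
      = (1 - A / (q * x j)) * (1 - A / x j) * qPoch q (A * q / x j) k := by
    have := hx j
    rw [qPoch_succ', qPoch_succ', ← mul_assoc]
    congr 2 <;> field_simp
  rw [vwpTerm_eq_erase _ _ _ j, upBase, scaleExcept_self,
    prod_erase_scaleExcept q⁻¹ x j fun y => qPoch q y (k + 2),
    prod_erase_scaleExcept q⁻¹ x j fun y => qPoch q (A * q⁻¹ ^ 2 * q / y) (k + 2), downFactor,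
    Finset.prod_congr rfl fun i _ => show qPoch q (A * q⁻¹ ^ 2 * q / (x i * q⁻¹)) (k + 2)
      = qPoch q (A / x i) (k + 2) by
        congr 1; have := hx i; field_simp,
    show A * q⁻¹ ^ 2 * q / x j = A / (q * x j) by have := hx j; field_simp]
  rw [a3] at h7 ⊢
  rw [a4] at h8 ⊢
  rw [a2, a1, qPoch_succ q (A * q / x j) (k + 1), qPoch_succ q (A * q / x j) k, e2,
    qPoch_succ q (x j) (k + 1), qPoch_succ q (x j) k]
  have f1 : 1 - q ^ (k + 1) * A / x j = 1 - A * q / x j * q ^ k := by ring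
  rw [f1, show 1 - q ^ (k + 1) * x j = 1 - x j * q ^ (k + 1) by ring,
    show 1 - q ^ (k + 1) * (A * q / x j) = 1 - A * q / x j * q ^ (k + 1) by ring,
    show 1 - A * q⁻¹ ^ 2 * (q ^ (k + 2)) ^ 2 = 1 - A * (q ^ (k + 1)) ^ 2 by field_simp; ring]
  generalize ∏ i ∈ Finset.univ.erase j, qPoch q (A * q / x i) (k + 1) = D at *
  generalize ∏ i ∈ Finset.univ.erase j, (1 - A / x i) = D' at *
  generalize ∏ i ∈ Finset.univ.erase j, qPoch q (x i) (k + 1) = N at *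
  generalize ∏ i ∈ Finset.univ.erase j, (1 - x i / q) = N' at *
  generalize qPoch q (A * q / x j) k = V at *
  generalize 1 - A / (q * x j) = v at *
  generalize 1 - A / x j = v' at *
  generalize qPoch q q (k + 2) = U at *
  generalize 1 - A * (q ^ (k + 1)) ^ 2 = y
  generalize 1 - A * q / x j * q ^ (k + 1) = y1 at *
  generalize 1 - A * q / x j * q ^ k = y2 at *
  generalize qPoch q A k = P at *
  generalize qPoch q (x j) k = W at *
  generalize 1 - x j * q ^ k = w1
  generalize 1 - x j * q ^ (k + 1) = w2
  clear a1 a2 a3 a4 f1 e2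
  generalize 1 - A * q⁻¹ ^ 2 = r at *
  generalize 1 - A = r0 at *
  generalize 1 - A / q = r1 at *
  have hD' : D' ≠ 0 := left_ne_zero_of_mul h7
  have hv : v ≠ 0 := left_ne_zero_of_mul (left_ne_zero_of_mul h8)
  have hv' : v' ≠ 0 := right_ne_zero_of_mul (left_ne_zero_of_mul h8)
  field_simp
  ring
end

section
variable {q A : ℂ} {x : Fin 7 → ℂ} {j : Fin 7}

/-- The antidifference in the contiguous relation, without its scalar factor. -/
noncomputable def upPrimitive (q A : ℂ) (x : Fin 7 → ℂ) (j : Fin 7) (k : ℕ) : ℂ :=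
  qPoch q A k * qPoch q (x j) k * (∏ i ∈ Finset.univ.erase j, qPoch q (x i) (k + 1))
      * (∏ i ∈ Finset.univ.erase j, (1 - q ^ (k + 1) * (A / x i)))
    / ((1 - A) * qPoch q q (k + 1) * qPoch q (A * q / x j) (k + 1)
      * ∏ i ∈ Finset.univ.erase j, qPoch q (A * q / x i) (k + 1))

/-- This lemma and the next put two consecutive values of the primitive over the same base, so that
their difference is the bracket on the left of the certificate at t = q^(k+1). -/
theorem upPrimitive_eq_upBase (hq : ‖q‖ < 1) (h : VwpRegular q A x) (k : ℕ) :
    upPrimitive q A x j k = upBase q A x j k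
      * ((∏ i ∈ Finset.univ.erase j, (1 - q ^ (k + 1) * (A / x i))) * (1 - q ^ (k + 1) * q)
        * (1 - q ^ (k + 1) * (A * q / x j))) := by
  have hQ := pow_succ_ne_one_of_norm_lt_one hq
  have h2 := qPoch_ne_zero hQ (k + 1)
  have h3 := one_sub_mul_pow_ne_zero hQ (k + 1)
  have h4 := qPoch_ne_zero (h.2 j) (k + 1)
  have h5 := one_sub_mul_pow_ne_zero (h.2 j) (k + 1)
  rw [upPrimitive, upBase, qPoch_succ q q (k + 1), qPoch_succ q _ (k + 1),
    mul_comm (q ^ (k + 1)) q, mul_comm (q ^ (k + 1)) (A * q / x j)]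
  generalize 1 - A * q / x j * q ^ (k + 1) = v at *
  generalize qPoch q (A * q / x j) (k + 1) = V at *
  generalize 1 - q * q ^ (k + 1) = u at *
  generalize qPoch q q (k + 1) = U at *
  generalize 1 - A = r
  field_simp

theorem upPrimitive_succ_eq_upBase (hq0 : q ≠ 0) (h : VwpRegular q A x) (k : ℕ) :
    upPrimitive q A x j (k + 1) = upBase q A x j k
      * ((∏ i ∈ Finset.univ.erase j, (1 - q ^ (k + 1) * x i)) * (1 - q ^ (k + 1) * x j / q)
        * (1 - q ^ (k + 1) * A / q)) := by
  have h6 : ∏ i ∈ Finset.univ.erase j, (1 - A * q / x i * q ^ (k + 1)) ≠ 0 :=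
    Finset.prod_ne_zero_iff.2 fun i _ => one_sub_mul_pow_ne_zero (h.2 i) (k + 1)
  have e1 : 1 - q ^ (k + 1) * A / q = 1 - A * q ^ k := by field_simp; ring
  have e2 : 1 - q ^ (k + 1) * x j / q = 1 - x j * q ^ k := by field_simp; ring
  have e3 : ∏ i ∈ Finset.univ.erase j, (1 - q ^ (k + 1 + 1) * (A / x i))
      = ∏ i ∈ Finset.univ.erase j, (1 - A * q / x i * q ^ (k + 1)) :=
    Finset.prod_congr rfl fun i _ => by ring
  have e4 : ∏ i ∈ Finset.univ.erase j, (1 - q ^ (k + 1) * x i)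
      = ∏ i ∈ Finset.univ.erase j, (1 - x i * q ^ (k + 1)) :=
    Finset.prod_congr rfl fun i _ => by ring
  rw [upPrimitive, upBase, e1, e2, e3, e4, prod_qPoch_succ q _ _ (k + 1),
    prod_qPoch_succ q _ (fun i => A * q / x i) (k + 1), qPoch_succ q A, qPoch_succ q (x j)]
  generalize ∏ i ∈ Finset.univ.erase j, (1 - A * q / x i * q ^ (k + 1)) = D at *
  generalize ∏ i ∈ Finset.univ.erase j, (1 - x i * q ^ (k + 1)) = D'
  generalize ∏ i ∈ Finset.univ.erase j, qPoch q (A * q / x i) (k + 1) = D''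
  generalize 1 - A = r
  field_simp

/-- Unlike the terms, the primitive carries no factor q^k. Its limit is therefore an infinite
product, which in general is nonzero and is the boundary term of the single series. -/
theorem tendsto_upPrimitive (hq : ‖q‖ < 1) (h : VwpRegular q A x) :
    Tendsto (upPrimitive q A x j) atTop (𝓝 (vwpLimit q A x)) := by
  have hpow : Tendsto (fun k : ℕ => q ^ (k + 1)) atTop (𝓝 0) :=
    (tendsto_pow_atTop_nhds_zero_of_norm_lt_one hq).comp (tendsto_add_atTop_nat 1)
  have hs : ∀ a, Tendsto (fun k => qPoch q a (k + 1)) atTop (𝓝 (qPochInf q a)) := fun a =>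
    (tendsto_qPoch hq a).comp (tendsto_add_atTop_nat 1)
  have := (((((tendsto_qPoch hq A).mul (tendsto_qPoch hq (x j))).mul
    (tendsto_finsetProd (Finset.univ.erase j) fun i _ => hs (x i))).mul
    (tendsto_finsetProd (Finset.univ.erase j) fun i _ =>
      (hpow.mul_const (A / x i)).const_sub 1)).div
    ((((hs q).const_mul (1 - A)).mul (hs (A * q / x j))).mul
      (tendsto_finsetProd (Finset.univ.erase j) fun i _ => hs (A * q / x i))) ?_)
  · refine Eq.subst (motive := fun z => Tendsto _ atTop (𝓝 z)) ?_ this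
    have := h.one_sub_ne_zero
    rw [vwpLimit, prod_eq_mul_erase j, prod_eq_mul_erase j, qPochInf_eq hq A]
    simp only [zero_mul, sub_zero, Finset.prod_const_one, mul_one]
    field_simp
  · exact mul_ne_zero (mul_ne_zero (mul_ne_zero h.one_sub_ne_zero
      (qPochInf_ne_zero hq (pow_succ_ne_one_of_norm_lt_one hq))) (qPochInf_ne_zero hq (h.2 j)))
      (Finset.prod_ne_zero_iff.2 fun i _ => qPochInf_ne_zero hq (h.2 i))

theorem vwpTerm_zero (h : VwpRegular q A x) : vwpTerm q A x 0 = 1 := by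
  have := h.one_sub_ne_zero
  simp [vwpTerm, qPoch_zero, this]

/-- The contiguous relation of the very-well-poised balanced series in which `A` and all the
parameters but `x j` are shifted. -/
theorem tsum_vwpTerm_scaleExcept (hq0 : q ≠ 0) (hq : ‖q‖ < 1) (hx : ∀ i, x i ≠ 0)
    (hAq : 1 - A / q ≠ 0) (h : VwpRegular q A x)
    (hp : VwpRegular q (A * q ^ 2) (scaleExcept q x j))
    (hm : VwpRegular q (A * (q⁻¹) ^ 2) (scaleExcept q⁻¹ x j)) {α β γ S : ℂ}
    (hcert : ∀ t, S * (1 - x j / q) * ((∏ i ∈ Finset.univ.erase j, (1 - t * x i))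
          * (1 - t * x j / q) * (1 - t * A / q)
        - (∏ i ∈ Finset.univ.erase j, (1 - t * (A / x i))) * (1 - t * q)
          * (1 - t * (A * q / x j)))
      = t * (1 - A * t ^ 2) * (α * ((1 - t) * (1 - t * A) * (1 - t * q) * (1 - t * A / q))
        + β * (∏ i ∈ Finset.univ.erase j, (1 - x i / q)) * ((1 - t * A / x j) * (1 - t * x j)
          * (1 - t * (A * q / x j)) * (1 - t * x j / q))
        + γ * ((1 - t * x j / q) * (1 - t * A / q) * (1 - t * q) * (1 - t * (A * q / x j)))))
    (hcert₁ : S * ((∏ i ∈ Finset.univ.erase j, (1 - x i)) * (1 - x j / q) * (1 - A / q)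
        - (∏ i ∈ Finset.univ.erase j, (1 - A / x i)) * (1 - q) * (1 - A * q / x j))
      = (1 - A) * (β * (∏ i ∈ Finset.univ.erase j, (1 - x i / q)) * ((1 - A / x j) * (1 - x j)
          * (1 - A * q / x j))
        + γ * ((1 - A * q / x j) * (1 - q) * (1 - A / q))))
    (hβ : β * ((1 - A / (q * x j)) * (1 - A / x j)) = q * S) :
    α * upFactor q A x j * (∑' n, vwpTerm q (A * q ^ 2) (scaleExcept q x j) n)
      + β * downFactor q A x j * (∑' n, vwpTerm q (A * (q⁻¹) ^ 2) (scaleExcept q⁻¹ x j) n)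
      + γ * (∑' n, vwpTerm q A x n) = S * (1 - x j / q) * vwpLimit q A x := by
  have hQ := pow_succ_ne_one_of_norm_lt_one hq
  have hA := h.one_sub_ne_zero
  -- The lengths N, N+2, N+1 reflect the index offsets between the three series. With them each
  -- induction step adds exactly the three terms tied together by the certificate at t = q^(N+1).
  have partial_sum : ∀ N : ℕ,
      α * upFactor q A x j
          * (∑ n ∈ Finset.range N, vwpTerm q (A * q ^ 2) (scaleExcept q x j) n)
        + β * downFactor q A x j
          * (∑ n ∈ Finset.range (N + 2), vwpTerm q (A * (q⁻¹) ^ 2) (scaleExcept q⁻¹ x j) n)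
        + γ * (∑ n ∈ Finset.range (N + 1), vwpTerm q A x n)
      = S * (1 - x j / q) * upPrimitive q A x j N := by
    intro N
    induction N with
    | zero =>
      have g1 : 1 - q ≠ 0 := by simpa using one_sub_mul_pow_ne_zero hQ 0
      have g2 : 1 - A * q / x j ≠ 0 := by simpa using one_sub_mul_pow_ne_zero (h.2 j) 0
      have g3 : ∏ i ∈ Finset.univ.erase j, (1 - A * q / x i) ≠ 0 :=
        Finset.prod_ne_zero_iff.2 fun i _ => by simpa using one_sub_mul_pow_ne_zero (h.2 i) 0
      have g4 : ∏ i ∈ Finset.univ.erase j, (1 - A / x i) ≠ 0 :=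
        Finset.prod_ne_zero_iff.2 fun i hi => by
          convert one_sub_mul_pow_ne_zero (hm.2 i) 0 using 2
          rw [scaleExcept, if_neg (Finset.ne_of_mem_erase hi)]; have := hx i; field_simp
      have g5 : 1 - A / (q * x j) ≠ 0 := by
        convert one_sub_mul_pow_ne_zero (hm.2 j) 0 using 2
        rw [scaleExcept_self]; have := hx j; field_simp
      have g6 := hm.one_sub_ne_zero
      simp only [Finset.sum_range_zero, zero_add, Finset.sum_range_succ, vwpTerm_zero h,
        vwpTerm_zero hm]
      rw [vwpTerm_eq_erase _ _ _ j, scaleExcept_self,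
        prod_erase_scaleExcept q⁻¹ x j fun y => qPoch q y 1,
        prod_erase_scaleExcept q⁻¹ x j fun y => qPoch q (A * q⁻¹ ^ 2 * q / y) 1, downFactor,
        Finset.prod_congr rfl fun i _ => show qPoch q (A * q⁻¹ ^ 2 * q / (x i * q⁻¹)) 1
          = 1 - A / x i by
            simp only [qPoch, Finset.prod_range_one, pow_zero, mul_one]
            have := hx i; field_simp,
        show A * q⁻¹ ^ 2 * q / x j = A / (q * x j) by have := hx j; field_simp, upPrimitive]
      simp only [qPoch, Finset.prod_range_one, pow_zero, mul_one, zero_add, pow_one,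
        Finset.prod_range_zero, one_mul, mul_zero]
      rw [Finset.prod_congr rfl fun i _ => show 1 - q * (A / x i) = 1 - A * q / x i by ring,
        show 1 - A * q⁻¹ ^ 2 * q ^ 2 = 1 - A by field_simp]
      simp only [← div_eq_mul_inv]
      generalize 1 - A * q⁻¹ ^ 2 = r at *
      generalize 1 - A * q / x j = v at *
      generalize 1 - A / x j = v1 at *
      generalize 1 - x j / q = v2 at *
      generalize 1 - x j = v4 at *
      generalize 1 - A / (q * x j) = v3 at *
      generalize ∏ i ∈ Finset.univ.erase j, (1 - A * q / x i) = D at *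
      generalize ∏ i ∈ Finset.univ.erase j, (1 - A / x i) = D1 at *
      generalize ∏ i ∈ Finset.univ.erase j, (1 - x i / q) = D2 at *
      generalize ∏ i ∈ Finset.univ.erase j, (1 - x i) = D3 at *
      generalize 1 - A / q = r1 at *
      generalize 1 - A = r2 at *
      clear hcert
      generalize 1 - q = u at *
      field_simp
      -- `hcert₁` is `hcert` at t = 1 with 1 - x j / q cancelled. The lowered series also has a term
      -- of index 0, which the certificate does not reach; `hβ` accounts for it.
      linear_combination (D1 * v * u) * hβ - q * hcert₁
    | succ N ih =>
      rw [Finset.sum_range_succ (vwpTerm q (A * q ^ 2) (scaleExcept q x j)),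
        Finset.sum_range_succ (vwpTerm q (A * (q⁻¹) ^ 2) (scaleExcept q⁻¹ x j)) (N + 2),
        Finset.sum_range_succ (vwpTerm q A x) (N + 1)]
      have d := downFactor_mul_vwpTerm hq0 hq h hx hAq hm N
      have u := upFactor_mul_vwpTerm hq0 hq h hx hp N
      have v := vwpTerm_eq_upBase (j := j) hq0 hq h N
      have s := upPrimitive_eq_upBase (j := j) hq h N
      have s' := upPrimitive_succ_eq_upBase (j := j) hq0 h N
      have c := hcert (q ^ (N + 1))
      linear_combination ih + α * u + β * d + γ * v + S * (1 - x j / q) * (s - s')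
        - upBase q A x j N * c
  have t1 := (summable_vwpTerm hq hp).hasSum.tendsto_sum_nat
  have t2 := (summable_vwpTerm hq hm).hasSum.tendsto_sum_nat.comp (tendsto_add_atTop_nat 2)
  have t3 := (summable_vwpTerm hq h).hasSum.tendsto_sum_nat.comp (tendsto_add_atTop_nat 1)
  refine tendsto_nhds_unique (((t1.const_mul (α * upFactor q A x j)).add
    (t2.const_mul (β * downFactor q A x j))).add (t3.const_mul γ)) ?_
  simp only [Function.comp_def, partial_sum]
  exact (tendsto_upPrimitive hq h).const_mul _
end

/-! ### Contiguous relation shifting two parameters in opposite directions -/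

/-- Multiply `x p` by `r` and divide `x j` by `r`. -/
noncomputable def shiftPair (r : ℂ) (x : Fin 7 → ℂ) (p j : Fin 7) : Fin 7 → ℂ :=
  fun i => if i = p then x p * r else if i = j then x j * r⁻¹ else x i

theorem shiftPair_left (r : ℂ) (x : Fin 7 → ℂ) (p j : Fin 7) : shiftPair r x p j p = x p * r := by
  simp [shiftPair]

theorem shiftPair_right (r : ℂ) (x : Fin 7 → ℂ) {p j : Fin 7} (h : p ≠ j) :
    shiftPair r x p j j = x j * r⁻¹ := by
  simp [shiftPair, h.symm]

theorem shiftPair_inv (r : ℂ) (x : Fin 7 → ℂ) {p j : Fin 7} (h : p ≠ j) :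
    shiftPair r⁻¹ x p j = shiftPair r x j p := by
  funext i
  by_cases h1 : i = p
  · subst h1; simp [shiftPair, h]
  · by_cases h2 : i = j
    · subst h2; simp [shiftPair, h1]
    · simp [shiftPair, h1, h2]

theorem prod_erase_shiftPair (r : ℂ) (x : Fin 7 → ℂ) (p j : Fin 7) (f : ℂ → ℂ) :
    ∏ i ∈ (Finset.univ.erase j).erase p, f (shiftPair r x p j i)
      = ∏ i ∈ (Finset.univ.erase j).erase p, f (x i) :=
  Finset.prod_congr rfl fun i hi => by
    rw [shiftPair, if_neg (Finset.ne_of_mem_erase hi),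
      if_neg (Finset.ne_of_mem_erase (Finset.mem_of_mem_erase hi))]

theorem prod_eq_mul_erase_erase {p j : Fin 7} (hpj : p ≠ j) (f : Fin 7 → ℂ) :
    ∏ i, f i = f p * f j * ∏ i ∈ (Finset.univ.erase j).erase p, f i := by
  rw [prod_eq_mul_erase j, ← Finset.mul_prod_erase (Finset.univ.erase j) f
    (Finset.mem_erase.2 ⟨hpj, Finset.mem_univ p⟩)]
  ring

section
variable {q A : ℂ} {x : Fin 7 → ℂ} {p j : Fin 7}

/-- The common factor of the terms of the contiguous relation. -/
noncomputable def pairBase (q A : ℂ) (x : Fin 7 → ℂ) (p j : Fin 7) (k : ℕ) : ℂ :=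
  qPoch q A (k + 1) * qPoch q (x p) k * qPoch q (x j) k
      * (∏ i ∈ (Finset.univ.erase j).erase p, qPoch q (x i) (k + 1))
    / ((1 - A) * qPoch q q (k + 1) * qPoch q (A * q / x p) (k + 2) * qPoch q (A * q / x j) (k + 2)
      * ∏ i ∈ (Finset.univ.erase j).erase p, qPoch q (A * q / x i) (k + 1))

theorem pairBase_comm (k : ℕ) : pairBase q A x p j k = pairBase q A x j p k := by
  rw [pairBase, pairBase, Finset.erase_right_comm]
  ring

/-- Here `A` is not shifted, so all three series are compared at the same index k+1, again with t =
q^(k+1). -/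
theorem vwpTerm_eq_pairBase (hpj : p ≠ j) (hq0 : q ≠ 0) (hq : ‖q‖ < 1)
    (h : VwpRegular q A x) (k : ℕ) :
    vwpTerm q A x (k + 1) = pairBase q A x p j k * q ^ (k + 1)
      * ((1 - A * (q ^ (k + 1)) ^ 2) * ((1 - q ^ (k + 1) * x p / q) * (1 - q ^ (k + 1) * x j / q)
        * (1 - q ^ (k + 1) * (A * q / x p)) * (1 - q ^ (k + 1) * (A * q / x j)))) := by
  have hA := h.one_sub_ne_zero
  have hQ := qPoch_ne_zero (pow_succ_ne_one_of_norm_lt_one hq) (k + 1)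
  have hV := qPoch_ne_zero (h.2 j) (k + 1)
  have hU := qPoch_ne_zero (h.2 p) (k + 1)
  have hD : ∏ i ∈ (Finset.univ.erase j).erase p, qPoch q (A * q / x i) (k + 1) ≠ 0 :=
    Finset.prod_ne_zero_iff.2 fun i _ => qPoch_ne_zero (h.2 i) (k + 1)
  have h5 := one_sub_mul_pow_ne_zero (h.2 j) (k + 1)
  have h6 := one_sub_mul_pow_ne_zero (h.2 p) (k + 1)
  have e1 : 1 - q ^ (k + 1) * x p / q = 1 - x p * q ^ k := by field_simp; ring
  have e2 : 1 - q ^ (k + 1) * x j / q = 1 - x j * q ^ k := by field_simp; ring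
  rw [vwpTerm, prod_eq_mul_erase_erase hpj, prod_eq_mul_erase_erase hpj, pairBase, e1, e2,
    qPoch_succ q (A * q / x p) (k + 1), qPoch_succ q (A * q / x j) (k + 1),
    qPoch_succ q (x p) k, qPoch_succ q (x j) k]
  rw [mul_comm (q ^ (k + 1)) (A * q / x p), mul_comm (q ^ (k + 1)) (A * q / x j)]
  generalize ∏ i ∈ (Finset.univ.erase j).erase p, qPoch q (A * q / x i) (k + 1) = D at *
  generalize ∏ i ∈ (Finset.univ.erase j).erase p, qPoch q (x i) (k + 1) = N
  generalize qPoch q (A * q / x j) (k + 1) = V at *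
  generalize 1 - A * q / x j * q ^ (k + 1) = v at *
  generalize qPoch q (A * q / x p) (k + 1) = U at *
  generalize 1 - A * q / x p * q ^ (k + 1) = u at *
  generalize qPoch q q (k + 1) = Q at *
  generalize 1 - A * (q ^ (k + 1)) ^ 2 = y
  generalize 1 - A = r at *
  clear e1 e2
  field_simp

/-- The factor relating the coefficient of the series in which `x p` is raised and `x j` is
lowered to the certificate. -/
noncomputable def pairFactor (q A : ℂ) (x : Fin 7 → ℂ) (p j : Fin 7) : ℂ :=
  (1 - x p) * (1 - A / x p) / (1 - A * q / x j)

theorem pairFactor_mul_vwpTerm (hpj : p ≠ j) (hq0 : q ≠ 0) (h : VwpRegular q A x)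
    (hx : ∀ i, x i ≠ 0) (hp : VwpRegular q A (shiftPair q x p j)) (k : ℕ) :
    pairFactor q A x p j * vwpTerm q A (shiftPair q x p j) (k + 1)
      = pairBase q A x p j k * q ^ (k + 1) * ((1 - A * (q ^ (k + 1)) ^ 2)
        * ((1 - x j / q) * ((1 - q ^ (k + 1) * A / x p) * (1 - q ^ (k + 1) * x p)
          * (1 - q ^ (k + 1) * (A * q / x p)) * (1 - q ^ (k + 1) * x p / q)))) := by
  have h4 := qPoch_ne_zero (h.2 p) k
  have h4' := one_sub_mul_pow_ne_zero (h.2 p) k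
  have h4'' := one_sub_mul_pow_ne_zero (h.2 p) (k + 1)
  have h5 := qPoch_ne_zero (h.2 j) (k + 2)
  have h6 : 1 - A / x p ≠ 0 := by
    convert one_sub_mul_pow_ne_zero (hp.2 p) 0 using 2
    rw [shiftPair_left]; have := hx p; field_simp
  have e1 : 1 - q ^ (k + 1) * x p / q = 1 - x p * q ^ k := by field_simp; ring
  have a1 : (1 - x p) * qPoch q (x p * q) (k + 1) = qPoch q (x p) k * (1 - x p * q ^ k)
      * (1 - x p * q ^ (k + 1)) := by
    rw [← qPoch_succ', qPoch_succ, qPoch_succ]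
  have a2 : qPoch q (x j * q⁻¹) (k + 1) = (1 - x j / q) * qPoch q (x j) k := by
    rw [qPoch_succ']
    congr 2
    field_simp
  have a3 : (1 - A * q / x j) * qPoch q (A * q / (x j * q⁻¹)) (k + 1)
      = qPoch q (A * q / x j) (k + 2) := by
    rw [qPoch_succ' q (A * q / x j)]
    congr 2
    have := hx j
    field_simp
  have a4 : qPoch q (A * q / (x p * q)) (k + 1) = (1 - A / x p) * qPoch q (A * q / x p) k := by
    rw [qPoch_succ']
    have := hx p
    congr 2 <;> field_simp
  have f1 : 1 - q ^ (k + 1) * A / x p = 1 - A * q / x p * q ^ k := by ring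
  rw [vwpTerm, prod_eq_mul_erase_erase hpj, prod_eq_mul_erase_erase hpj,
    prod_erase_shiftPair q x p j fun y => qPoch q y (k + 1),
    prod_erase_shiftPair q x p j fun y => qPoch q (A * q / y) (k + 1),
    shiftPair_left, shiftPair_right q x hpj, pairBase, pairFactor, e1, f1, a2, a4,
    qPoch_succ q (A * q / x p) (k + 1), qPoch_succ q (A * q / x p) k,
    show 1 - q ^ (k + 1) * x p = 1 - x p * q ^ (k + 1) by ring,
    show 1 - q ^ (k + 1) * (A * q / x p) = 1 - A * q / x p * q ^ (k + 1) by ring]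
  rw [← a3] at h5 ⊢
  generalize ∏ i ∈ (Finset.univ.erase j).erase p, qPoch q (A * q / x i) (k + 1) = D at *
  generalize ∏ i ∈ (Finset.univ.erase j).erase p, qPoch q (x i) (k + 1) = N
  generalize qPoch q (A * q / (x j * q⁻¹)) (k + 1) = V at *
  generalize 1 - A * q / x j = v at *
  generalize qPoch q (A * q / x p) k = U at *
  generalize 1 - A * q / x p * q ^ k = u at *
  generalize 1 - A * q / x p * q ^ (k + 1) = u' at *
  generalize 1 - A / x p = y at *
  generalize qPoch q (x p * q) (k + 1) = P at *
  generalize qPoch q (x p) k = P' at *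
  generalize 1 - x p * q ^ k = w at *
  generalize 1 - x p * q ^ (k + 1) = w' at *
  generalize 1 - x p = w'' at *
  generalize 1 - A * (q ^ (k + 1)) ^ 2 = y
  generalize 1 - A = r
  generalize qPoch q A (k + 1) = A' at *
  generalize qPoch q q (k + 1) = Q' at *
  generalize qPoch q (x j) k = X at *
  generalize 1 - x j / q = X' at *
  clear a2 a3 a4 e1 f1
  have hV : V ≠ 0 := right_ne_zero_of_mul h5
  have hv : v ≠ 0 := left_ne_zero_of_mul h5
  -- If one of these denominators is zero, both sides are zero, by the convention for division.
  by_cases hr : r = 0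
  · simp [hr]
  by_cases hQ' : Q' = 0
  · simp [hQ']
  by_cases hD : D = 0
  · simp [hD]
  field_simp
  linear_combination A' * X * N * y * X' * a1

/-- The antidifference in the contiguous relation, without its scalar factor. -/
noncomputable def pairPrimitive (q A : ℂ) (x : Fin 7 → ℂ) (p j : Fin 7) (k : ℕ) : ℂ :=
  qPoch q A (k + 1) * qPoch q (x p) k * qPoch q (x j) k
      * (∏ i ∈ (Finset.univ.erase j).erase p, qPoch q (x i) (k + 1))
      * (∏ i ∈ (Finset.univ.erase j).erase p, (1 - q ^ (k + 1) * (A / x i))) * (1 - q ^ (k + 1))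
    / ((1 - A) * qPoch q q (k + 1) * qPoch q (A * q / x p) (k + 1) * qPoch q (A * q / x j) (k + 1)
      * ∏ i ∈ (Finset.univ.erase j).erase p, qPoch q (A * q / x i) (k + 1))

/-- The second product of the certificate now contains 1 - t and hence vanishes at t = 1. The
initial condition `hcert₁` of the summed relation therefore has only one product on its left. -/
theorem pairPrimitive_eq_pairBase (hq : ‖q‖ < 1) (h : VwpRegular q A x) (k : ℕ) :
    pairPrimitive q A x p j k = pairBase q A x p j k
      * ((∏ i ∈ (Finset.univ.erase j).erase p, (1 - q ^ (k + 1) * (A / x i))) * (1 - q ^ (k + 1))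
        * (1 - q ^ (k + 1) * (A * q / x p)) * (1 - q ^ (k + 1) * (A * q / x j))) := by
  have hA := h.one_sub_ne_zero
  have hQ := qPoch_ne_zero (pow_succ_ne_one_of_norm_lt_one hq) (k + 1)
  have hV := qPoch_ne_zero (h.2 j) (k + 1)
  have hU := qPoch_ne_zero (h.2 p) (k + 1)
  have hD : ∏ i ∈ (Finset.univ.erase j).erase p, qPoch q (A * q / x i) (k + 1) ≠ 0 :=
    Finset.prod_ne_zero_iff.2 fun i _ => qPoch_ne_zero (h.2 i) (k + 1)
  have h3 := one_sub_mul_pow_ne_zero (h.2 p) (k + 1)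
  have h5 := one_sub_mul_pow_ne_zero (h.2 j) (k + 1)
  rw [pairPrimitive, pairBase, qPoch_succ q (A * q / x p) (k + 1),
    qPoch_succ q (A * q / x j) (k + 1),
    mul_comm (q ^ (k + 1)) (A * q / x p), mul_comm (q ^ (k + 1)) (A * q / x j)]
  generalize 1 - A * q / x j * q ^ (k + 1) = v at *
  generalize qPoch q (A * q / x j) (k + 1) = V at *
  generalize 1 - A * q / x p * q ^ (k + 1) = u at *
  generalize qPoch q (A * q / x p) (k + 1) = U at *
  generalize ∏ i ∈ (Finset.univ.erase j).erase p, qPoch q (A * q / x i) (k + 1) = D at *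
  generalize qPoch q q (k + 1) = Q at *
  generalize 1 - A = r at *
  field_simp

theorem pairPrimitive_succ_eq_pairBase (hq0 : q ≠ 0) (hq : ‖q‖ < 1) (h : VwpRegular q A x)
    (k : ℕ) :
    pairPrimitive q A x p j (k + 1) = pairBase q A x p j k
      * ((∏ i ∈ (Finset.univ.erase j).erase p, (1 - q ^ (k + 1) * x i)) * (1 - q ^ (k + 1) * A)
        * (1 - q ^ (k + 1) * x p / q) * (1 - q ^ (k + 1) * x j / q)) := by
  have hA := h.one_sub_ne_zero
  have hQ := qPoch_ne_zero (pow_succ_ne_one_of_norm_lt_one hq) (k + 1)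
  have hV := qPoch_ne_zero (h.2 j) (k + 2)
  have hU := qPoch_ne_zero (h.2 p) (k + 2)
  have hD : ∏ i ∈ (Finset.univ.erase j).erase p, qPoch q (A * q / x i) (k + 1) ≠ 0 :=
    Finset.prod_ne_zero_iff.2 fun i _ => qPoch_ne_zero (h.2 i) (k + 1)
  have h3 := one_sub_mul_pow_ne_zero (pow_succ_ne_one_of_norm_lt_one hq) (k + 1)
  have h6 : ∏ i ∈ (Finset.univ.erase j).erase p, (1 - A * q / x i * q ^ (k + 1)) ≠ 0 :=
    Finset.prod_ne_zero_iff.2 fun i _ => one_sub_mul_pow_ne_zero (h.2 i) (k + 1)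
  have e1 : 1 - q ^ (k + 1) * x p / q = 1 - x p * q ^ k := by field_simp; ring
  have e2 : 1 - q ^ (k + 1) * x j / q = 1 - x j * q ^ k := by field_simp; ring
  have e3 : ∏ i ∈ (Finset.univ.erase j).erase p, (1 - q ^ (k + 1 + 1) * (A / x i))
      = ∏ i ∈ (Finset.univ.erase j).erase p, (1 - A * q / x i * q ^ (k + 1)) :=
    Finset.prod_congr rfl fun i _ => by ring
  have e4 : ∏ i ∈ (Finset.univ.erase j).erase p, (1 - q ^ (k + 1) * x i)
      = ∏ i ∈ (Finset.univ.erase j).erase p, (1 - x i * q ^ (k + 1)) :=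
    Finset.prod_congr rfl fun i _ => by ring
  rw [pairPrimitive, pairBase, e1, e2, e3, e4, prod_qPoch_succ q _ _ (k + 1),
    prod_qPoch_succ q _ (fun i => A * q / x i) (k + 1), qPoch_succ q A (k + 1),
    qPoch_succ q (x p) k, qPoch_succ q (x j) k, qPoch_succ q q (k + 1),
    show 1 - q ^ (k + 1) * A = 1 - A * q ^ (k + 1) by ring,
    show 1 - q ^ (k + 1 + 1) = 1 - q * q ^ (k + 1) by ring]
  generalize ∏ i ∈ (Finset.univ.erase j).erase p, (1 - A * q / x i * q ^ (k + 1)) = D at *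
  generalize ∏ i ∈ (Finset.univ.erase j).erase p, (1 - x i * q ^ (k + 1)) = D'
  generalize ∏ i ∈ (Finset.univ.erase j).erase p, qPoch q (A * q / x i) (k + 1) = D''
  generalize 1 - q * q ^ (k + 1) = v at *
  generalize qPoch q q (k + 1) = Q at *
  generalize qPoch q (A * q / x j) (k + 1 + 1) = V at *
  generalize qPoch q (A * q / x p) (k + 1 + 1) = U at *
  generalize 1 - A = r at *
  generalize 1 - A * q ^ (k + 1) = r1 at *
  generalize 1 - x j * q ^ k = r2 at *
  generalize 1 - x p * q ^ k = r3 at *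
  clear e1 e2 e3 e4
  field_simp

theorem tendsto_pairPrimitive (hpj : p ≠ j) (hq : ‖q‖ < 1) (h : VwpRegular q A x) :
    Tendsto (pairPrimitive q A x p j) atTop (𝓝 (vwpLimit q A x)) := by
  have hpow : Tendsto (fun k : ℕ => q ^ (k + 1)) atTop (𝓝 0) :=
    (tendsto_pow_atTop_nhds_zero_of_norm_lt_one hq).comp (tendsto_add_atTop_nat 1)
  have hs : ∀ a, Tendsto (fun k => qPoch q a (k + 1)) atTop (𝓝 (qPochInf q a)) := fun a =>
    (tendsto_qPoch hq a).comp (tendsto_add_atTop_nat 1)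
  have := (((((((hs A).mul (tendsto_qPoch hq (x p))).mul (tendsto_qPoch hq (x j))).mul
    (tendsto_finsetProd ((Finset.univ.erase j).erase p) fun i _ => hs (x i))).mul
    (tendsto_finsetProd ((Finset.univ.erase j).erase p) fun i _ =>
      (hpow.mul_const (A / x i)).const_sub 1)).mul (hpow.const_sub 1)).div
    (((((hs q).const_mul (1 - A)).mul (hs (A * q / x p))).mul (hs (A * q / x j))).mul
      (tendsto_finsetProd ((Finset.univ.erase j).erase p) fun i _ => hs (A * q / x i))) ?_)
  · refine Eq.subst (motive := fun z => Tendsto _ atTop (𝓝 z)) ?_ this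
    have := h.one_sub_ne_zero
    rw [vwpLimit, prod_eq_mul_erase_erase hpj, prod_eq_mul_erase_erase hpj, qPochInf_eq hq A]
    simp only [zero_mul, sub_zero, Finset.prod_const_one, mul_one]
    field_simp
  · exact mul_ne_zero (mul_ne_zero (mul_ne_zero (mul_ne_zero h.one_sub_ne_zero
      (qPochInf_ne_zero hq (pow_succ_ne_one_of_norm_lt_one hq))) (qPochInf_ne_zero hq (h.2 p)))
      (qPochInf_ne_zero hq (h.2 j)))
      (Finset.prod_ne_zero_iff.2 fun i _ => qPochInf_ne_zero hq (h.2 i))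

/-- The contiguous relation of the very-well-poised balanced series in which `x p` and `x j` are
shifted in opposite directions. -/
theorem tsum_vwpTerm_shiftPair (hpj : p ≠ j) (hq0 : q ≠ 0) (hq : ‖q‖ < 1) (hx : ∀ i, x i ≠ 0)
    (h : VwpRegular q A x) (hp : VwpRegular q A (shiftPair q x p j))
    (hm : VwpRegular q A (shiftPair q x j p)) {α β γ S : ℂ}
    (hcert : ∀ t, S * ((∏ i ∈ (Finset.univ.erase j).erase p, (1 - t * x i))
          * (1 - t * A) * (1 - t * x p / q) * (1 - t * x j / q)
        - (∏ i ∈ (Finset.univ.erase j).erase p, (1 - t * (A / x i))) * (1 - t)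
          * (1 - t * (A * q / x p)) * (1 - t * (A * q / x j)))
      = t * (1 - A * t ^ 2) * (α * (1 - x j / q) * ((1 - t * A / x p) * (1 - t * x p)
          * (1 - t * (A * q / x p)) * (1 - t * x p / q))
        + β * (1 - x p / q) * ((1 - t * A / x j) * (1 - t * x j)
          * (1 - t * (A * q / x j)) * (1 - t * x j / q))
        + γ * ((1 - t * x p / q) * (1 - t * x j / q) * (1 - t * (A * q / x p))
          * (1 - t * (A * q / x j)))))
    (hcert₁ : S * (∏ i ∈ (Finset.univ.erase j).erase p, (1 - x i))
      = α * ((1 - A / x p) * (1 - x p) * (1 - A * q / x p))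
        + β * ((1 - A / x j) * (1 - x j) * (1 - A * q / x j))
        + γ * ((1 - A * q / x p) * (1 - A * q / x j))) :
    α * pairFactor q A x p j * (∑' n, vwpTerm q A (shiftPair q x p j) n)
      + β * pairFactor q A x j p * (∑' n, vwpTerm q A (shiftPair q x j p) n)
      + γ * (∑' n, vwpTerm q A x n) = S * vwpLimit q A x := by
  have hQ := pow_succ_ne_one_of_norm_lt_one hq
  have hA := h.one_sub_ne_zero
  have partial_sum : ∀ N : ℕ,
      α * pairFactor q A x p j
          * (∑ n ∈ Finset.range (N + 1), vwpTerm q A (shiftPair q x p j) n)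
        + β * pairFactor q A x j p
          * (∑ n ∈ Finset.range (N + 1), vwpTerm q A (shiftPair q x j p) n)
        + γ * (∑ n ∈ Finset.range (N + 1), vwpTerm q A x n)
      = S * pairPrimitive q A x p j N := by
    intro N
    induction N with
    | zero =>
      have g1 : 1 - q ≠ 0 := by simpa using one_sub_mul_pow_ne_zero hQ 0
      have g2 : 1 - A * q / x j ≠ 0 := by simpa using one_sub_mul_pow_ne_zero (h.2 j) 0
      have g2' : 1 - A * q / x p ≠ 0 := by simpa using one_sub_mul_pow_ne_zero (h.2 p) 0
      have g3 : ∏ i ∈ (Finset.univ.erase j).erase p, (1 - A * q / x i) ≠ 0 :=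
        Finset.prod_ne_zero_iff.2 fun i _ => by simpa using one_sub_mul_pow_ne_zero (h.2 i) 0
      simp only [zero_add, Finset.sum_range_one, vwpTerm_zero h, vwpTerm_zero hp, vwpTerm_zero hm]
      rw [pairFactor, pairFactor, pairPrimitive]
      simp only [qPoch, Finset.prod_range_one, pow_zero, mul_one, zero_add, pow_one,
        Finset.prod_range_zero]
      rw [Finset.prod_congr rfl fun i _ => show 1 - q * (A / x i) = 1 - A * q / x i by ring]
      generalize 1 - A * q / x j = v at *
      generalize 1 - A * q / x p = v' at *
      generalize 1 - A / x j = v1 at *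
      generalize 1 - A / x p = v1' at *
      generalize 1 - x j = v4 at *
      generalize 1 - x p = v4' at *
      generalize ∏ i ∈ (Finset.univ.erase j).erase p, (1 - A * q / x i) = D at *
      generalize ∏ i ∈ (Finset.univ.erase j).erase p, (1 - x i) = D3 at *
      generalize 1 - A = r2 at *
      clear hcert
      generalize 1 - q = u at *
      field_simp
      -- `hcert₁` is `hcert` at t = 1 with (1 - A)(1 - x p / q)(1 - x j / q) cancelled. The last two
      -- factors may vanish, so it is a separate hypothesis.
      linear_combination -hcert₁
    | succ N ih =>
      rw [Finset.sum_range_succ (vwpTerm q A (shiftPair q x p j)) (N + 1),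
        Finset.sum_range_succ (vwpTerm q A (shiftPair q x j p)) (N + 1),
        Finset.sum_range_succ (vwpTerm q A x) (N + 1)]
      have d := pairFactor_mul_vwpTerm hpj.symm hq0 h hx hm N
      rw [← pairBase_comm] at d
      have u := pairFactor_mul_vwpTerm hpj hq0 h hx hp N
      have v := vwpTerm_eq_pairBase hpj hq0 hq h N
      have s := pairPrimitive_eq_pairBase (p := p) (j := j) hq h N
      have s' := pairPrimitive_succ_eq_pairBase (p := p) (j := j) hq0 hq h N
      have c := hcert (q ^ (N + 1))
      linear_combination ih + α * u + β * d + γ * v + S * (s - s') - pairBase q A x p j N * c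
  have t1 := (summable_vwpTerm hq hp).hasSum.tendsto_sum_nat.comp (tendsto_add_atTop_nat 1)
  have t2 := (summable_vwpTerm hq hm).hasSum.tendsto_sum_nat.comp (tendsto_add_atTop_nat 1)
  have t3 := (summable_vwpTerm hq h).hasSum.tendsto_sum_nat.comp (tendsto_add_atTop_nat 1)
  refine tendsto_nhds_unique (((t1.const_mul (α * pairFactor q A x p j)).add
    (t2.const_mul (β * pairFactor q A x j p))).add (t3.const_mul γ)) ?_
  simp only [Function.comp_def, partial_sum]
  exact (tendsto_pairPrimitive hpj hq h).const_mul _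
end

/-! ### The certificate for the parameters `x`, with g = `x 5` -/

section
variable {q a : ℂ} {x : Fin 7 → ℂ}

theorem exists_esymm_five {K : Type*} [Field K] (y₁ y₂ y₃ y₄ y₅ : K) (h₁ : y₁ ≠ 0) (h₂ : y₂ ≠ 0)
    (h₃ : y₃ ≠ 0) (h₄ : y₄ ≠ 0) (h₅ : y₅ ≠ 0) :
    ∃ e₁ e₂ e₃ e₄ e₅ : K, e₅ = y₁ * y₂ * y₃ * y₄ * y₅ ∧ e₁ = y₁ + y₂ + y₃ + y₄ + y₅ ∧
      e₄ / e₅ = 1 / y₁ + 1 / y₂ + 1 / y₃ + 1 / y₄ + 1 / y₅ ∧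
      (∀ s, (1 - s * y₁) * (1 - s * y₂) * (1 - s * y₃) * (1 - s * y₄) * (1 - s * y₅)
        = 1 - e₁ * s + e₂ * s ^ 2 - e₃ * s ^ 3 + e₄ * s ^ 4 - e₅ * s ^ 5) ∧
      ∀ s, (1 - s / y₁) * (1 - s / y₂) * (1 - s / y₃) * (1 - s / y₄) * (1 - s / y₅)
        = -(s ^ 5 - e₁ * s ^ 4 + e₂ * s ^ 3 - e₃ * s ^ 2 + e₄ * s - e₅) / e₅ := by
  refine ⟨_, y₁ * y₂ + y₁ * y₃ + y₁ * y₄ + y₁ * y₅ + y₂ * y₃ + y₂ * y₄ + y₂ * y₅ + y₃ * y₄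
    + y₃ * y₅ + y₄ * y₅, y₁ * y₂ * y₃ + y₁ * y₂ * y₄ + y₁ * y₂ * y₅ + y₁ * y₃ * y₄ + y₁ * y₃ * y₅
    + y₁ * y₄ * y₅ + y₂ * y₃ * y₄ + y₂ * y₃ * y₅ + y₂ * y₄ * y₅ + y₃ * y₄ * y₅,
    y₂ * y₃ * y₄ * y₅ + y₁ * y₃ * y₄ * y₅ + y₁ * y₂ * y₄ * y₅ + y₁ * y₂ * y₃ * y₅
    + y₁ * y₂ * y₃ * y₄, _, rfl, rfl, ?_, ?_, ?_⟩
  · field_simp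
  · intro s; ring
  · intro s; field_simp; ring

/-- The certificates depend on the parameters only through these symmetric polynomials, which keeps
the polynomial identities small and treats all positions of the distinguished parameter alike. -/
theorem exists_esymm_erase (hx : ∀ i, x i ≠ 0) {p : Fin 7} (hp : p ≠ 5) :
    ∃ e₁ e₂ e₃ e₄ e₅ : ℂ, e₅ = ∏ i ∈ (Finset.univ.erase 5).erase p, x i ∧
      e₁ = ∑ i ∈ (Finset.univ.erase 5).erase p, x i ∧
      e₄ / e₅ = ∑ i ∈ (Finset.univ.erase 5).erase p, 1 / x i ∧
      (∀ s, ∏ i ∈ (Finset.univ.erase 5).erase p, (1 - s * x i)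
        = 1 - e₁ * s + e₂ * s ^ 2 - e₃ * s ^ 3 + e₄ * s ^ 4 - e₅ * s ^ 5) ∧
      ∀ s, ∏ i ∈ (Finset.univ.erase 5).erase p, (1 - s / x i)
        = -(s ^ 5 - e₁ * s ^ 4 + e₂ * s ^ 3 - e₃ * s ^ 2 + e₄ * s - e₅) / e₅ := by
  have key : ∃ i₁ i₂ i₃ i₄ i₅ : Fin 7, (Finset.univ.erase 5).erase p = {i₁, i₂, i₃, i₄, i₅} ∧
      i₁ ≠ i₂ ∧ i₁ ≠ i₃ ∧ i₁ ≠ i₄ ∧ i₁ ≠ i₅ ∧ i₂ ≠ i₃ ∧ i₂ ≠ i₄ ∧ i₂ ≠ i₅ ∧ i₃ ≠ i₄ ∧ i₃ ≠ i₅ ∧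
      i₄ ≠ i₅ := by
    fin_cases p
    · exact ⟨1, 2, 3, 4, 6, by decide⟩
    · exact ⟨0, 2, 3, 4, 6, by decide⟩
    · exact ⟨0, 1, 3, 4, 6, by decide⟩
    · exact ⟨0, 1, 2, 4, 6, by decide⟩
    · exact ⟨0, 1, 2, 3, 6, by decide⟩
    · exact absurd rfl hp
    · exact ⟨0, 1, 2, 3, 4, by decide⟩
  obtain ⟨i₁, i₂, i₃, i₄, i₅, hs, h12, h13, h14, h15, h23, h24, h25, h34, h35, h45⟩ := key
  rw [hs]
  simp only [Finset.prod_insert, Finset.sum_insert, Finset.mem_insert, Finset.mem_singleton,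
    Finset.prod_singleton, Finset.sum_singleton, h12, h13, h14, h15, h23, h24, h25, h34, h35, h45,
    or_self, not_false_eq_true, ← mul_assoc, ← add_assoc]
  exact exists_esymm_five _ _ _ _ _ (hx _) (hx _) (hx _) (hx _) (hx _)

/-- The scalar in front of the antidifference, for the parameter `g = x 5`. -/
noncomputable def certS (q a : ℂ) (x : Fin 7 → ℂ) : ℂ :=
  -q * (1 - a / (x 5 * q)) * (1 - a / x 5) * (1 - a * q / x 5)

/-- The certificate coefficient of the raised series is
`certA q a x * ∏ i ≠ 5, (1 - x 5 / (a * q) * x i)`. -/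
noncomputable def certA (q a : ℂ) (x : Fin 7 → ℂ) : ℂ :=
  -(a ^ 3 * q ^ 3 / x 5 ^ 3) * (1 - a / (x 5 * q))

/-- The certificate coefficient of the lowered series is `certB q a x * ∏ i ≠ 5, (1 - x i / q)`. -/
noncomputable def certB (q a : ℂ) (x : Fin 7 → ℂ) : ℂ :=
  -q ^ 2 * (1 - a * q / x 5)

/-- The certificate coefficient of the unshifted series. -/
noncomputable def certG (q a : ℂ) (x : Fin 7 → ℂ) : ℂ :=
  -(certA q a x * ∏ i ∈ Finset.univ.erase 5, (1 - x 5 / (a * q) * x i))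
    - certB q a x * ∏ i ∈ Finset.univ.erase 5, (1 - x i / q)
    + a * (certS q a x * (1 - x 5 / q)) * ((∑ i ∈ Finset.univ.erase 5, 1 / x i)
      - (∑ i ∈ Finset.univ.erase 5, x i) / a - x 5 / (a * q) - 1 / q + q / a + q / x 5)

/-- One parameter is adjoined to the five of `exists_esymm_erase` by e_k ↦ e_k + x₀ e_{k-1}; the
choice of index 0 is arbitrary. -/
theorem exists_esymm_six (hx : ∀ i, x i ≠ 0) :
    ∃ e₁ e₂ e₃ e₄ e₅ e₆ : ℂ, e₆ = ∏ i ∈ Finset.univ.erase 5, x i ∧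
      e₁ = ∑ i ∈ Finset.univ.erase 5, x i ∧
      e₅ / e₆ = ∑ i ∈ Finset.univ.erase 5, 1 / x i ∧
      (∀ s, ∏ i ∈ Finset.univ.erase 5, (1 - s * x i)
        = 1 - e₁ * s + e₂ * s ^ 2 - e₃ * s ^ 3 + e₄ * s ^ 4 - e₅ * s ^ 5 + e₆ * s ^ 6) ∧
      ∀ s, ∏ i ∈ Finset.univ.erase 5, (1 - s / x i)
        = (s ^ 6 - e₁ * s ^ 5 + e₂ * s ^ 4 - e₃ * s ^ 3 + e₄ * s ^ 2 - e₅ * s + e₆) / e₆ := by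
  have h0 : (0 : Fin 7) ≠ 5 := by decide
  obtain ⟨e₁, e₂, e₃, e₄, e₅, h5, h1, h45, hE, hE'⟩ := exists_esymm_erase hx h0
  have hm : (0 : Fin 7) ∈ Finset.univ.erase 5 := by decide
  have hx0 := hx 0
  have h50 : e₅ ≠ 0 := by
    rw [h5]; exact Finset.prod_ne_zero_iff.2 fun i _ => hx i
  simp only [← Finset.mul_prod_erase _ _ hm, ← Finset.add_sum_erase _ _ hm]
  refine ⟨x 0 + e₁, x 0 * e₁ + e₂, x 0 * e₂ + e₃, x 0 * e₃ + e₄, x 0 * e₄ + e₅, x 0 * e₅,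
    by rw [h5], by rw [h1], ?_, fun s => ?_, fun s => ?_⟩
  · rw [← h45]; field_simp; ring
  · rw [hE]; ring
  · rw [hE']; field_simp; ring

theorem prod_erase_five (hx : ∀ i, x i ≠ 0) (hbal : ∏ i, x i = a ^ 3 * q ^ 2) :
    ∏ i ∈ Finset.univ.erase 5, x i = a ^ 3 * q ^ 2 / x 5 := by
  rw [← hbal, prod_eq_mul_erase 5, mul_div_cancel_left₀ _ (hx 5)]

theorem certificate (hq0 : q ≠ 0) (ha : a ≠ 0) (hx : ∀ i, x i ≠ 0)
    (hbal : ∏ i, x i = a ^ 3 * q ^ 2) (t : ℂ) :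
    certS q a x * (1 - x 5 / q) * ((∏ i ∈ Finset.univ.erase 5, (1 - t * x i))
          * (1 - t * x 5 / q) * (1 - t * a / q)
        - (∏ i ∈ Finset.univ.erase 5, (1 - t * (a / x i))) * (1 - t * q)
          * (1 - t * (a * q / x 5)))
      = t * (1 - a * t ^ 2)
        * (certA q a x * (∏ i ∈ Finset.univ.erase 5, (1 - x 5 / (a * q) * x i))
          * ((1 - t) * (1 - t * a) * (1 - t * q) * (1 - t * a / q))
        + certB q a x * (∏ i ∈ Finset.univ.erase 5, (1 - x i / q)) * ((1 - t * a / x 5)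
          * (1 - t * x 5) * (1 - t * (a * q / x 5)) * (1 - t * x 5 / q))
        + certG q a x * ((1 - t * x 5 / q) * (1 - t * a / q) * (1 - t * q)
          * (1 - t * (a * q / x 5)))) := by
  obtain ⟨e₁, e₂, e₃, e₄, e₅, e₆, h6, h1, h56, hE, hE'⟩ := exists_esymm_six hx
  have hB : ∏ i ∈ Finset.univ.erase 5, (1 - x i / q)
      = ∏ i ∈ Finset.univ.erase 5, (1 - 1 / q * x i) :=
    Finset.prod_congr rfl fun i _ => by ring
  -- The variable of the rational certificate is a·q^n, whereas the summation lemmas use q^n.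
  have h := certificate_of_esymm (t := a * t) (S := certS q a x * (1 - x 5 / q))
    (α := certA q a x * ∏ i ∈ Finset.univ.erase 5, (1 - x 5 / (a * q) * x i))
    (β := certB q a x * ∏ i ∈ Finset.univ.erase 5, (1 - x i / q)) (γ := certG q a x)
    ha hq0 (hx 5) (h6.trans (prod_erase_five hx hbal)) hE hE'
    (by rw [certS]; ring) (by rw [certA]) (by rw [hB, certB]) (by rw [certG, h1, h56])
  have hs : ∀ i, a * t / x i = t * (a / x i) := fun i => by ring
  have h5 := hx 5
  rw [mul_div_cancel_left₀ t ha] at h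
  simp only [hs] at h
  rw [show a * t * x 5 / (a * q) = t * x 5 / q by field_simp,
    show a * t * x 5 / a = t * x 5 by field_simp, show q * (a * t) / a = t * q by field_simp,
    show a * t * q / x 5 = t * (a * q / x 5) by ring, show (a * t) ^ 2 / a = a * t ^ 2 by field_simp,
    show a * t / q = t * a / q by ring, show a * t = t * a by ring,
    show t * (a / x 5) = t * a / x 5 by ring] at h
  linear_combination h

theorem certificate_one (hq0 : q ≠ 0) (ha : a ≠ 0) (hx : ∀ i, x i ≠ 0)
    (hbal : ∏ i, x i = a ^ 3 * q ^ 2) :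
    certS q a x * ((∏ i ∈ Finset.univ.erase 5, (1 - x i)) * (1 - x 5 / q) * (1 - a / q)
        - (∏ i ∈ Finset.univ.erase 5, (1 - a / x i)) * (1 - q) * (1 - a * q / x 5))
      = (1 - a) * (certB q a x * (∏ i ∈ Finset.univ.erase 5, (1 - x i / q))
          * ((1 - a / x 5) * (1 - x 5) * (1 - a * q / x 5))
        + certG q a x * ((1 - a * q / x 5) * (1 - q) * (1 - a / q))) := by
  obtain ⟨e₁, e₂, e₃, e₄, e₅, e₆, h6, h1, h56, hE, hE'⟩ := exists_esymm_six hx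
  have hB : ∏ i ∈ Finset.univ.erase 5, (1 - x i / q)
      = ∏ i ∈ Finset.univ.erase 5, (1 - 1 / q * x i) :=
    Finset.prod_congr rfl fun i _ => by ring
  have h := certificate_of_esymm_at_a (S := certS q a x)
    (α := certA q a x * ∏ i ∈ Finset.univ.erase 5, (1 - x 5 / (a * q) * x i))
    (β := certB q a x * ∏ i ∈ Finset.univ.erase 5, (1 - x i / q)) (γ := certG q a x)
    ha hq0 (hx 5) (h6.trans (prod_erase_five hx hbal)) hE hE'
    (by rw [certS]) (by rw [certA]) (by rw [hB, certB]) (by rw [certG, h1, h56])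
  simp only [one_mul] at h
  exact h

theorem certificate_five (hq0 : q ≠ 0) (ha : a ≠ 0) (hx : ∀ i, x i ≠ 0)
    (hbal : ∏ i, x i = a ^ 3 * q ^ 2) :
    certS q a x * ((∏ i ∈ Finset.univ.erase 5, (1 - x 5 / a * x i)) * (1 - x 5 / q)
          * (1 - x 5 ^ 2 / (a * q))
        - (∏ i ∈ Finset.univ.erase 5, (1 - x 5 / x i)) * (1 - q) * (1 - x 5 * q / a))
      = x 5 / a * (1 - x 5 ^ 2 / a)
        * (certA q a x * (∏ i ∈ Finset.univ.erase 5, (1 - x 5 / (a * q) * x i))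
          * ((1 - x 5 / a) * (1 - x 5) * (1 - x 5 * q / a))
        + certG q a x * ((1 - x 5 * q / a) * (1 - q) * (1 - x 5 ^ 2 / (a * q)))) := by
  obtain ⟨e₁, e₂, e₃, e₄, e₅, e₆, h6, h1, h56, hE, hE'⟩ := exists_esymm_six hx
  have hB : ∏ i ∈ Finset.univ.erase 5, (1 - x i / q)
      = ∏ i ∈ Finset.univ.erase 5, (1 - 1 / q * x i) :=
    Finset.prod_congr rfl fun i _ => by ring
  have h := certificate_of_esymm_at_g (S := certS q a x)
    (α := certA q a x * ∏ i ∈ Finset.univ.erase 5, (1 - x 5 / (a * q) * x i))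
    (β := certB q a x * ∏ i ∈ Finset.univ.erase 5, (1 - x i / q)) (γ := certG q a x)
    ha hq0 (hx 5) (h6.trans (prod_erase_five hx hbal)) hE hE'
    (by rw [certS]) (by rw [certA]) (by rw [hB, certB]) (by rw [certG, h1, h56])
  exact h

theorem certificate_other (hq0 : q ≠ 0) (ha : a ≠ 0) (hx : ∀ i, x i ≠ 0)
    (hbal : ∏ i, x i = a ^ 3 * q ^ 2) {p : Fin 7} (hp : p ≠ 5) :
    certS q a x * (1 - x 5 / q) * ((∏ i ∈ (Finset.univ.erase 5).erase p, (1 - x p / a * x i))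
          * (1 - x p * x 5 / (a * q)))
      = x p / a
        * (certA q a x * (∏ i ∈ Finset.univ.erase 5, (1 - x 5 / (a * q) * x i))
          * ((1 - x p / a) * (1 - x p) * (1 - q * x p / a))
        + certB q a x * (∏ i ∈ (Finset.univ.erase 5).erase p, (1 - x i / q))
          * ((1 - x p / x 5) * (1 - x p * x 5 / a) * (1 - x p * q / x 5)
            * (1 - x p * x 5 / (a * q)))
        + certG q a x * ((1 - x p * q / x 5) * (1 - x p * x 5 / (a * q)) * (1 - q * x p / a))) := by
  obtain ⟨e₁, e₂, e₃, e₄, e₅, h5, h1, h45, hE, hE'⟩ := exists_esymm_erase hx hp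
  have hm : p ∈ Finset.univ.erase 5 := Finset.mem_erase.2 ⟨hp, Finset.mem_univ p⟩
  have hB : ∏ i ∈ (Finset.univ.erase 5).erase p, (1 - x i / q)
      = ∏ i ∈ (Finset.univ.erase 5).erase p, (1 - 1 / q * x i) :=
    Finset.prod_congr rfl fun i _ => by ring
  have he : e₅ = a ^ 3 * q ^ 2 / (x 5 * x p) := by
    have h50 := hx 5
    have hp0 := hx p
    rw [h5, ← hbal, prod_eq_mul_erase_erase hp]
    field_simp
  refine certificate_of_esymm_at_b (S := certS q a x * (1 - x 5 / q))
    (α := certA q a x * ∏ i ∈ Finset.univ.erase 5, (1 - x 5 / (a * q) * x i))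
    (β := certB q a x * ∏ i ∈ (Finset.univ.erase 5).erase p, (1 - x i / q)) (γ := certG q a x)
    ha hq0 (hx 5) (hx p) he hE (by rw [certS]; ring) ?_ (by rw [hB, certB]) ?_
  -- The symmetric polynomials omit `x p`, so its contribution is split off from the products and
  -- sums over six parameters.
  · rw [certA, ← Finset.mul_prod_erase _ _ hm]; ring
  · rw [certG, ← Finset.mul_prod_erase _ (fun i => 1 - x i / q) hm, ← Finset.add_sum_erase _ _ hm,
      ← Finset.add_sum_erase _ _ hm, h1, h45]
    ring
end

/-! ### Complementary parameters and their coefficient under the shifts -/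

section
variable {q a : ℂ} {x : Fin 7 → ℂ} {p j : Fin 7}

theorem complParams_self : complParams a x p p = x p := by simp [complParams]

theorem complParams_of_ne {i : Fin 7} (h : i ≠ p) : complParams a x p i = x p * x i / a := by
  simp [complParams, h]

theorem prod_erase_complParams (f : ℂ → ℂ) :
    ∏ i ∈ Finset.univ.erase p, f (complParams a x p i)
      = ∏ i ∈ Finset.univ.erase p, f (x p * x i / a) :=
  Finset.prod_congr rfl fun i hi => by rw [complParams_of_ne (Finset.ne_of_mem_erase hi)]

theorem prod_erase_erase_complParams (f : ℂ → ℂ) :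
    ∏ i ∈ (Finset.univ.erase j).erase p, f (complParams a x p i)
      = ∏ i ∈ (Finset.univ.erase j).erase p, f (x p * x i / a) :=
  Finset.prod_congr rfl fun i hi => by rw [complParams_of_ne (Finset.ne_of_mem_erase hi)]

theorem scaleExcept_of_ne (r : ℂ) {i : Fin 7} (h : i ≠ j) : scaleExcept r x j i = x i * r := by
  simp [scaleExcept, h]

/-- Multiplying a by r² and x_p by r fixes x_p²/a. The ratio x_p x_i / a is unchanged for i ≠ j and
loses one r for i = j, since x_j is not scaled; x_p itself gains one. -/
theorem complParams_scaleExcept {r : ℂ} (hr : r ≠ 0) (hpj : p ≠ j) :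
    complParams (a * r ^ 2) (scaleExcept r x j) p = shiftPair r (complParams a x p) p j := by
  funext i
  by_cases h1 : i = p
  · subst h1
    rw [complParams_self, shiftPair_left, complParams_self, scaleExcept_of_ne r hpj]
  · rw [complParams_of_ne h1, scaleExcept_of_ne r hpj]
    by_cases h2 : i = j
    · subst h2
      rw [shiftPair_right r _ hpj, complParams_of_ne h1, scaleExcept_self]
      field_simp
    · rw [shiftPair, if_neg h1, if_neg h2, complParams_of_ne h1, scaleExcept_of_ne r h2]
      field_simp

/-- When the unscaled parameter is the distinguished one, a occurs only in denominators, and the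
shift acts on the complementary series in the reverse direction. -/
theorem complParams_scaleExcept_self {r : ℂ} (hr : r ≠ 0) :
    complParams (a * r ^ 2) (scaleExcept r x j) j = scaleExcept r⁻¹ (complParams a x j) j := by
  funext i
  by_cases h1 : i = j
  · subst h1
    simp only [complParams_self, scaleExcept_self]
  · rw [complParams_of_ne h1, scaleExcept_of_ne r h1, scaleExcept_of_ne r⁻¹ h1,
      complParams_of_ne h1, scaleExcept_self]
    field_simp

theorem qPochInf_step (hq : ‖q‖ < 1) {y z : ℂ} (h : y * q = z) :
    qPochInf q y = (1 - y) * qPochInf q z := by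
  rw [qPochInf_eq hq y, h]

theorem prod_qPochInf_step (hq : ‖q‖ < 1) {s : Finset (Fin 7)} {y z : Fin 7 → ℂ}
    (h : ∀ i, y i * q = z i) :
    ∏ i ∈ s, qPochInf q (y i) = (∏ i ∈ s, (1 - y i)) * ∏ i ∈ s, qPochInf q (z i) := by
  rw [← Finset.prod_mul_distrib]
  exact Finset.prod_congr rfl fun i _ => qPochInf_step hq (h i)

theorem prod_qPochInf_ne_zero (hq : ‖q‖ < 1) {s : Finset (Fin 7)} {y : Fin 7 → ℂ}
    (h : ∀ i ∈ s, ∀ n : ℕ, y i * q ^ n ≠ 1) : ∏ i ∈ s, qPochInf q (y i) ≠ 0 :=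
  Finset.prod_ne_zero_iff.2 fun i hi => qPochInf_ne_zero hq (h i hi)

theorem PhiNonsingular.vwpRegular (h : PhiNonsingular q a x p) : VwpRegular q a x :=
  .of_w10Den h.2.2.1

theorem PhiNonsingular.vwpRegular_compl (h : PhiNonsingular q a x p) :
    VwpRegular q (x p ^ 2 / a) (complParams a x p) :=
  .of_w10Den h.2.2.2.1

theorem PhiNonsingular.compl_self (h : PhiNonsingular q a x p) (n : ℕ) :
    x p * q / a * q ^ n ≠ 1 := by
  convert h.vwpRegular_compl.2 p n using 2
  have := h.1
  have := h.2.1 p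
  rw [complParams_self]
  field_simp

theorem PhiNonsingular.compl_of_ne (h : PhiNonsingular q a x p) {i : Fin 7} (hi : i ≠ p) (n : ℕ) :
    x p * q / x i * q ^ n ≠ 1 := by
  convert h.vwpRegular_compl.2 i n using 2
  have := h.1
  have := h.2.1 p
  have := h.2.1 i
  rw [complParams_of_ne hi]
  field_simp

theorem complCoeff_eq (q a : ℂ) (x : Fin 7 → ℂ) (p : Fin 7) :
    complCoeff q a x p = (qPochInf q (a * q) * qPochInf q (x p / a)
      * ((∏ i ∈ Finset.univ.erase p, qPochInf q (x i))
        * ∏ i ∈ Finset.univ.erase p, qPochInf q (x p * q / x i)))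
    / (qPochInf q (x p ^ 2 * q / a) * qPochInf q (a / x p)
      * ((∏ i ∈ Finset.univ.erase p, qPochInf q (a * q / x i))
        * ∏ i ∈ Finset.univ.erase p, qPochInf q (x p * x i / a))) := by
  rw [complCoeff, Finset.prod_mul_distrib, Finset.prod_mul_distrib]

theorem prod_erase_eq (hpj : p ≠ j) (f : Fin 7 → ℂ) :
    ∏ i ∈ Finset.univ.erase p, f i = f j * ∏ i ∈ (Finset.univ.erase j).erase p, f i := by
  rw [Finset.erase_right_comm, Finset.mul_prod_erase _ _
    (Finset.mem_erase.2 ⟨hpj.symm, Finset.mem_univ j⟩)]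

/-- This is why the boundary terms cancel in Φ. Nearly all infinite products occur on both sides;
the sign and the factor x_p/a come from comparing the leading factors of (x_p/a)_∞ and (a/x_p)_∞. -/
theorem complCoeff_mul_vwpLimit (hq : ‖q‖ < 1) (h : PhiNonsingular q a x p) :
    complCoeff q a x p * vwpLimit q (x p ^ 2 / a) (complParams a x p)
      = -(x p / a) * vwpLimit q a x := by
  have ha := h.1
  have hx := h.2.1
  have hxp := hx p
  have b1 : qPochInf q (x p ^ 2 * q / a) ≠ 0 := qPochInf_ne_zero hq h.2.2.2.2.1
  have b2 : qPochInf q (a / x p) ≠ 0 := qPochInf_ne_zero hq h.2.2.2.2.2.1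
  have b3 : ∏ i ∈ Finset.univ.erase p, qPochInf q (x p * x i / a) ≠ 0 :=
    prod_qPochInf_ne_zero hq fun i hi => h.2.2.2.2.2.2.2 i (Finset.ne_of_mem_erase hi)
  have b4 : ∏ i ∈ Finset.univ.erase p, qPochInf q (x p * q / x i) ≠ 0 :=
    prod_qPochInf_ne_zero hq fun i hi => h.compl_of_ne (Finset.ne_of_mem_erase hi)
  have b5 : qPochInf q (x p * q / a) ≠ 0 := qPochInf_ne_zero hq h.compl_self
  have b6 := qPochInf_ne_zero hq (pow_succ_ne_one_of_norm_lt_one hq)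
  have b7 : ∏ i ∈ Finset.univ.erase p, qPochInf q (a * q / x i) ≠ 0 :=
    prod_qPochInf_ne_zero hq fun i _ => h.vwpRegular.2 i
  have e1 : qPochInf q (x p / a) = (1 - x p / a) * qPochInf q (x p * q / a) :=
    qPochInf_step hq (by ring)
  have e2 : qPochInf q (a / x p) = (1 - a / x p) * qPochInf q (a * q / x p) :=
    qPochInf_step hq (by ring)
  have e3 : 1 - x p / a = -(x p / a) * (1 - a / x p) := by field_simp; ring
  have e4 : ∏ i ∈ Finset.univ.erase p, qPochInf q (x p ^ 2 / a * q / (x p * x i / a))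
      = ∏ i ∈ Finset.univ.erase p, qPochInf q (x p * q / x i) :=
    Finset.prod_congr rfl fun i _ => by
      congr 1; have := hx i; field_simp
  rw [complCoeff_eq, vwpLimit, vwpLimit, prod_eq_mul_erase p, prod_eq_mul_erase p,
    prod_eq_mul_erase p, prod_eq_mul_erase p, complParams_self,
    prod_erase_complParams fun y => qPochInf q y,
    prod_erase_complParams fun y => qPochInf q (x p ^ 2 / a * q / y), e4, e1, e3,
    show x p ^ 2 / a * q / x p = x p * q / a by field_simp,
    show x p ^ 2 / a * q = x p ^ 2 * q / a by ring]
  rw [e2] at b2 ⊢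
  have b2' := left_ne_zero_of_mul b2
  have b2'' := right_ne_zero_of_mul b2
  generalize ∏ i ∈ Finset.univ.erase p, qPochInf q (x p * x i / a) = Y1 at *
  generalize ∏ i ∈ Finset.univ.erase p, qPochInf q (x p * q / x i) = Y2 at *
  generalize ∏ i ∈ Finset.univ.erase p, qPochInf q (a * q / x i) = Y3 at *
  generalize qPochInf q (x p ^ 2 * q / a) = Y4 at *
  generalize qPochInf q (x p * q / a) = Y5 at *
  generalize qPochInf q (a * q / x p) = Y6 at *
  generalize qPochInf q q = Y7 at *
  generalize 1 - a / x p = Y8 at *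
  clear e1 e2 e3 e4 b2
  field_simp

/-- Each infinite product gains or loses finitely many leading factors under the shift, and these
turn the factor of the raised principal series into that of the complementary one. The extra factor
on the left is 1 - X_j/q for the lowered complementary parameter X_j, the one that
`pairFactor_mul_vwpTerm` leaves outside. -/
theorem upFactor_mul_complCoeff (hq0 : q ≠ 0) (hq : ‖q‖ < 1) (hpj : p ≠ j)
    (h : PhiNonsingular q a x p) (hp : PhiNonsingular q (a * q ^ 2) (scaleExcept q x j) p) :
    upFactor q a x j * complCoeff q (a * q ^ 2) (scaleExcept q x j) p
        * (1 - x p * x j / (a * q))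
      = complCoeff q a x p * pairFactor q (x p ^ 2 / a) (complParams a x p) p j := by
  have ha := h.1
  have hx := h.2.1
  have hxp := hx p
  have hxj := hx j
  have e1 : qPochInf q (a * q) = (1 - a * q) * ((1 - a * q ^ 2) * qPochInf q (a * q ^ 2 * q)) := by
    rw [qPochInf_step hq (z := a * q ^ 2) (by ring), qPochInf_eq hq (a * q ^ 2)]
  have e2 : qPochInf q (x p * q / (a * q ^ 2)) = (1 - x p / (a * q)) * qPochInf q (x p / a) := by
    rw [qPochInf_step hq (z := x p / a) (by field_simp)]
    congr 2; field_simp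
  have e3 : qPochInf q (x p * q / x j) = (1 - x p * q / x j) * qPochInf q (x p * q * q / x j) :=
    qPochInf_step hq (by ring)
  have e4 : qPochInf q (a / x p) = (1 - a / x p) * qPochInf q (a * q ^ 2 / (x p * q)) :=
    qPochInf_step hq (by field_simp)
  have e5 : qPochInf q (a * q / x j) = (1 - a * q / x j)
      * ((1 - a * q ^ 2 / x j) * qPochInf q (a * q ^ 2 * q / x j)) := by
    rw [qPochInf_step hq (z := a * q ^ 2 / x j) (by ring),
      qPochInf_step hq (z := a * q ^ 2 * q / x j) (by ring)]
  have e6 : qPochInf q (x p * q * x j / (a * q ^ 2))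
      = (1 - x p * x j / (a * q)) * qPochInf q (x p * x j / a) := by
    rw [qPochInf_step hq (z := x p * x j / a) (by field_simp)]
    congr 2; field_simp
  have s1 : ∏ i ∈ (Finset.univ.erase j).erase p, qPochInf q (x i)
      = (∏ i ∈ (Finset.univ.erase j).erase p, (1 - x i))
        * ∏ i ∈ (Finset.univ.erase j).erase p, qPochInf q (x i * q) :=
    prod_qPochInf_step hq fun i => rfl
  have s2 : ∏ i ∈ (Finset.univ.erase j).erase p, qPochInf q (a * q / x i)
      = (∏ i ∈ (Finset.univ.erase j).erase p, (1 - a * q / x i))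
        * ∏ i ∈ (Finset.univ.erase j).erase p, qPochInf q (a * q ^ 2 * q / (x i * q)) :=
    prod_qPochInf_step hq fun i => by have := hx i; field_simp
  have s3 : ∏ i ∈ (Finset.univ.erase j).erase p, qPochInf q (x p * q * q / (x i * q))
      = ∏ i ∈ (Finset.univ.erase j).erase p, qPochInf q (x p * q / x i) :=
    Finset.prod_congr rfl fun i _ => by congr 1; have := hx i; field_simp
  have s4 : ∏ i ∈ (Finset.univ.erase j).erase p, qPochInf q (x p * q * (x i * q) / (a * q ^ 2))
      = ∏ i ∈ (Finset.univ.erase j).erase p, qPochInf q (x p * x i / a) :=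
    Finset.prod_congr rfl fun i _ => by congr 1; field_simp
  have sc : ∀ f : ℂ → ℂ, ∏ i ∈ (Finset.univ.erase j).erase p, f (scaleExcept q x j i)
      = ∏ i ∈ (Finset.univ.erase j).erase p, f (x i * q) := fun f =>
    Finset.prod_congr rfl fun i hi => by
      rw [scaleExcept_of_ne q (Finset.ne_of_mem_erase (Finset.mem_of_mem_erase hi))]
  have b1 : qPochInf q (x p ^ 2 * q / a) ≠ 0 := qPochInf_ne_zero hq h.2.2.2.2.1
  have b2 : qPochInf q (a / x p) ≠ 0 := qPochInf_ne_zero hq h.2.2.2.2.2.1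
  have b3 : ∏ i ∈ (Finset.univ.erase j).erase p, qPochInf q (x p * x i / a) ≠ 0 :=
    prod_qPochInf_ne_zero hq fun i hi => h.2.2.2.2.2.2.2 i (Finset.ne_of_mem_erase hi)
  have b4 : qPochInf q (x p * q / x j) ≠ 0 := qPochInf_ne_zero hq (h.compl_of_ne hpj.symm)
  have b5 : qPochInf q (a * q / x j) ≠ 0 := qPochInf_ne_zero hq (h.vwpRegular.2 j)
  have b6 : ∏ i ∈ (Finset.univ.erase j).erase p, qPochInf q (a * q / x i) ≠ 0 :=
    prod_qPochInf_ne_zero hq fun i _ => h.vwpRegular.2 i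
  have b7 : qPochInf q (x p * q * x j / (a * q ^ 2)) ≠ 0 := by
    have := qPochInf_ne_zero hq (hp.2.2.2.2.2.2.2 j hpj.symm)
    rwa [scaleExcept_self, scaleExcept_of_ne q hpj] at this
  have b8 : 1 - a * q / x p ≠ 0 := by
    simpa using one_sub_mul_pow_ne_zero (h.vwpRegular.2 p) 0
  have f1 : 1 - x p / a = -(x p / a) * (1 - a / x p) := by field_simp; ring
  have f2 : 1 - x p / (a * q) = -(x p / (a * q)) * (1 - a * q / x p) := by field_simp; ring
  have hm : p ∈ Finset.univ.erase j := Finset.mem_erase.2 ⟨hpj, Finset.mem_univ p⟩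
  rw [complCoeff_eq, complCoeff_eq, pairFactor, complParams_self, complParams_of_ne hpj.symm,
    upFactor]
  simp only [prod_erase_eq hpj, ← Finset.mul_prod_erase _ _ hm]
  rw [sc fun y => qPochInf q y, sc fun y => qPochInf q (scaleExcept q x j p * q / y),
    sc fun y => qPochInf q (a * q ^ 2 * q / y),
    sc fun y => qPochInf q (scaleExcept q x j p * y / (a * q ^ 2)),
    scaleExcept_self, scaleExcept_of_ne q hpj,
    show (x p * q) ^ 2 * q / (a * q ^ 2) = x p ^ 2 * q / a by field_simp,
    show x p ^ 2 / a / x p = x p / a by field_simp,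
    show x p ^ 2 / a * q / (x p * x j / a) = x p * q / x j by field_simp]
  rw [e6] at b7 ⊢
  rw [e5] at b5 ⊢
  rw [e4] at b2 ⊢
  rw [e3] at b4 ⊢
  rw [s2] at b6 ⊢
  rw [s1, s3, s4, e1, e2, f1, f2]
  clear s1 s2 s3 s4 e1 e2 e3 e4 e5 e6 f1 f2 sc
  generalize ∏ i ∈ (Finset.univ.erase j).erase p, qPochInf q (x p * x i / a) = Y1 at *
  generalize ∏ i ∈ (Finset.univ.erase j).erase p, qPochInf q (x p * q / x i) = Y2 at *
  generalize ∏ i ∈ (Finset.univ.erase j).erase p, qPochInf q (a * q ^ 2 * q / (x i * q)) = Y3 at *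
  generalize ∏ i ∈ (Finset.univ.erase j).erase p, (1 - a * q / x i) = Y4 at *
  generalize ∏ i ∈ (Finset.univ.erase j).erase p, qPochInf q (x i * q) = Y5 at *
  generalize ∏ i ∈ (Finset.univ.erase j).erase p, (1 - x i) = Y6 at *
  generalize qPochInf q (x p * x j / a) = Y7 at *
  generalize 1 - x p * x j / (a * q) = Y8 at *
  generalize qPochInf q (a * q ^ 2 * q / x j) = Y9 at *
  generalize qPochInf q (a * q ^ 2 / (x p * q)) = Z1 at *
  generalize qPochInf q (x p * q * q / x j) = Z2 at *
  generalize 1 - x p * q / x j = Z3 at *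
  generalize 1 - a * q / x p = Z4 at *
  generalize 1 - a / x p = Z5 at *
  generalize 1 - a * q / x j = Z6 at *
  generalize 1 - a * q ^ 2 / x j = Z7 at *
  generalize qPochInf q (x p ^ 2 * q / a) = Z8 at *
  have c1 := left_ne_zero_of_mul b7
  have c2 := right_ne_zero_of_mul b7
  have c3 := left_ne_zero_of_mul b5
  have c4 := left_ne_zero_of_mul (right_ne_zero_of_mul b5)
  have c5 := right_ne_zero_of_mul (right_ne_zero_of_mul b5)
  have c6 := left_ne_zero_of_mul b2
  have c7 := right_ne_zero_of_mul b2
  have c8 := left_ne_zero_of_mul b4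
  have c9 := right_ne_zero_of_mul b4
  have d1 := left_ne_zero_of_mul b6
  have d2 := right_ne_zero_of_mul b6
  clear b2 b4 b5 b6 b7
  field_simp

theorem downFactor_mul_complCoeff (hq0 : q ≠ 0) (hq : ‖q‖ < 1) (hpj : p ≠ j)
    (hAq : 1 - a / q ≠ 0) (h : PhiNonsingular q a x p)
    (hm : PhiNonsingular q (a * q⁻¹ ^ 2) (scaleExcept q⁻¹ x j) p) :
    downFactor q a x j * complCoeff q (a * q⁻¹ ^ 2) (scaleExcept q⁻¹ x j) p
      = complCoeff q a x p * ((∏ i ∈ (Finset.univ.erase j).erase p, (1 - x i / q))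
        * pairFactor q (x p ^ 2 / a) (complParams a x p) j p) := by
  have ha := h.1
  have hx := h.2.1
  have hxp := hx p
  have hxj := hx j
  have hA := h.vwpRegular.one_sub_ne_zero
  have e1 : qPochInf q (a * q⁻¹ ^ 2 * q) = (1 - a / q) * ((1 - a) * qPochInf q (a * q)) := by
    rw [← qPochInf_eq hq a, qPochInf_step hq (z := a) (by field_simp)]
    congr 2; field_simp
  have e2 : qPochInf q (x p / a) = (1 - x p / a) * qPochInf q (x p * q⁻¹ / (a * q⁻¹ ^ 2)) :=
    qPochInf_step hq (by field_simp)
  have e3 : qPochInf q (x p * q⁻¹ * q / x j) = (1 - x p / x j) * qPochInf q (x p * q / x j) := by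
    rw [qPochInf_step hq (z := x p * q / x j) (by field_simp)]
    congr 2; field_simp
  have e4 : qPochInf q (a * q⁻¹ ^ 2 / (x p * q⁻¹)) = (1 - a / (x p * q)) * qPochInf q (a / x p) := by
    rw [qPochInf_step hq (z := a / x p) (by field_simp)]
    congr 2; field_simp
  have e5 : qPochInf q (a * q⁻¹ ^ 2 * q / x j) = (1 - a / (q * x j))
      * ((1 - a / x j) * qPochInf q (a * q / x j)) := by
    rw [← qPochInf_step hq (y := a / x j) (by ring),
      qPochInf_step hq (z := a / x j) (by field_simp)]
    congr 2; field_simp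
  have e6 : qPochInf q (x p * x j / a)
      = (1 - x p * x j / a) * qPochInf q (x p * q⁻¹ * x j / (a * q⁻¹ ^ 2)) :=
    qPochInf_step hq (by field_simp)
  have s1 : ∏ i ∈ (Finset.univ.erase j).erase p, qPochInf q (x i * q⁻¹)
      = (∏ i ∈ (Finset.univ.erase j).erase p, (1 - x i / q))
        * ∏ i ∈ (Finset.univ.erase j).erase p, qPochInf q (x i) := by
    simp only [← div_eq_mul_inv]
    exact prod_qPochInf_step hq fun i => by field_simp
  have s2 : ∏ i ∈ (Finset.univ.erase j).erase p, qPochInf q (a * q⁻¹ ^ 2 * q / (x i * q⁻¹))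
      = (∏ i ∈ (Finset.univ.erase j).erase p, (1 - a / x i))
        * ∏ i ∈ (Finset.univ.erase j).erase p, qPochInf q (a * q / x i) := by
    rw [← prod_qPochInf_step hq fun i => show a / x i * q = a * q / x i by ring]
    exact Finset.prod_congr rfl fun i _ => by congr 1; have := hx i; field_simp
  have s3 : ∏ i ∈ (Finset.univ.erase j).erase p, qPochInf q (x p * q⁻¹ * q / (x i * q⁻¹))
      = ∏ i ∈ (Finset.univ.erase j).erase p, qPochInf q (x p * q / x i) :=
    Finset.prod_congr rfl fun i _ => by congr 1; have := hx i; field_simp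
  have s4 : ∏ i ∈ (Finset.univ.erase j).erase p,
      qPochInf q (x p * q⁻¹ * (x i * q⁻¹) / (a * q⁻¹ ^ 2))
      = ∏ i ∈ (Finset.univ.erase j).erase p, qPochInf q (x p * x i / a) :=
    Finset.prod_congr rfl fun i _ => by congr 1; field_simp
  have sc : ∀ f : ℂ → ℂ, ∏ i ∈ (Finset.univ.erase j).erase p, f (scaleExcept q⁻¹ x j i)
      = ∏ i ∈ (Finset.univ.erase j).erase p, f (x i * q⁻¹) := fun f =>
    Finset.prod_congr rfl fun i hi => by
      rw [scaleExcept_of_ne _ (Finset.ne_of_mem_erase (Finset.mem_of_mem_erase hi))]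
  have b1 : qPochInf q (x p ^ 2 * q / a) ≠ 0 := qPochInf_ne_zero hq h.2.2.2.2.1
  have b2 : qPochInf q (a / x p) ≠ 0 := qPochInf_ne_zero hq h.2.2.2.2.2.1
  have b2' : 1 - a / x p ≠ 0 := by
    simpa using one_sub_mul_pow_ne_zero h.2.2.2.2.2.1 0
  have b3 : ∏ i ∈ (Finset.univ.erase j).erase p, qPochInf q (x p * x i / a) ≠ 0 :=
    prod_qPochInf_ne_zero hq fun i hi => h.2.2.2.2.2.2.2 i (Finset.ne_of_mem_erase hi)
  have b5 : qPochInf q (a * q / x j) ≠ 0 := qPochInf_ne_zero hq (h.vwpRegular.2 j)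
  have b5' : qPochInf q (a * q⁻¹ ^ 2 * q / x j) ≠ 0 := by
    have := qPochInf_ne_zero hq (hm.vwpRegular.2 j)
    rwa [scaleExcept_self] at this
  have b6 : ∏ i ∈ (Finset.univ.erase j).erase p,
      qPochInf q (a * q⁻¹ ^ 2 * q / (x i * q⁻¹)) ≠ 0 := by
    rw [← sc fun y => qPochInf q (a * q⁻¹ ^ 2 * q / y)]
    exact prod_qPochInf_ne_zero hq fun i _ => hm.vwpRegular.2 i
  have b7 : qPochInf q (x p * x j / a) ≠ 0 :=
    qPochInf_ne_zero hq (h.2.2.2.2.2.2.2 j hpj.symm)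
  have b8 : 1 - x p * q / a ≠ 0 := by
    simpa using one_sub_mul_pow_ne_zero h.compl_self 0
  have f1 : 1 - x p / a = -(x p / a) * (1 - a / x p) := by field_simp; ring
  have f2 : 1 - a / (x p * q) = -(a / (x p * q)) * (1 - x p * q / a) := by field_simp; ring
  have hm : p ∈ Finset.univ.erase j := Finset.mem_erase.2 ⟨hpj, Finset.mem_univ p⟩
  rw [complCoeff_eq, complCoeff_eq, pairFactor, complParams_self, complParams_of_ne hpj.symm,
    downFactor]
  simp only [prod_erase_eq hpj, ← Finset.mul_prod_erase _ _ hm]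
  rw [sc fun y => qPochInf q y, sc fun y => qPochInf q (scaleExcept q⁻¹ x j p * q / y),
    sc fun y => qPochInf q (a * q⁻¹ ^ 2 * q / y),
    sc fun y => qPochInf q (scaleExcept q⁻¹ x j p * y / (a * q⁻¹ ^ 2)),
    scaleExcept_self, scaleExcept_of_ne _ hpj,
    show (x p * q⁻¹) ^ 2 * q / (a * q⁻¹ ^ 2) = x p ^ 2 * q / a by field_simp,
    show x p ^ 2 / a * q / x p = x p * q / a by field_simp,
    show x p ^ 2 / a / (x p * x j / a) = x p / x j by field_simp]
  rw [e6] at b7 ⊢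
  rw [e5] at b5' ⊢
  rw [s2] at b6 ⊢
  rw [s1, s3, s4, e1, e2, e3, e4, f1, f2]
  clear s1 s2 s3 s4 e1 e2 e3 e4 e5 e6 f1 f2 sc
  generalize ∏ i ∈ (Finset.univ.erase j).erase p, qPochInf q (x p * x i / a) = Y1 at *
  generalize ∏ i ∈ (Finset.univ.erase j).erase p, qPochInf q (x p * q / x i) = Y2 at *
  generalize ∏ i ∈ (Finset.univ.erase j).erase p, qPochInf q (a * q / x i) = Y3 at *
  generalize ∏ i ∈ (Finset.univ.erase j).erase p, (1 - a / x i) = Y4 at *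
  generalize ∏ i ∈ (Finset.univ.erase j).erase p, qPochInf q (x i) = Y5 at *
  generalize ∏ i ∈ (Finset.univ.erase j).erase p, (1 - x i / q) = Y6 at *
  generalize 1 - x p * x j / a = Y8 at *
  generalize qPochInf q (x p * q⁻¹ * x j / (a * q⁻¹ ^ 2)) = Y7 at *
  generalize qPochInf q (a * q / x j) = Y9 at *
  generalize qPochInf q (a / x p) = Z1 at *
  generalize qPochInf q (x p * q / x j) = Z2 at *
  generalize qPochInf q (x p * q⁻¹ / (a * q⁻¹ ^ 2)) = Z3 at *
  generalize 1 - a / x p = Z5 at *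
  generalize 1 - x p * q / a = Z4 at *
  generalize 1 - a / x j = Z6 at *
  generalize 1 - a / (q * x j) = Z7 at *
  generalize 1 - a / q = Z9 at *
  generalize 1 - a = Z0 at *
  generalize qPochInf q (x p ^ 2 * q / a) = Z8 at *
  have c1 := left_ne_zero_of_mul b7
  have c2 := right_ne_zero_of_mul b7
  have c3 := left_ne_zero_of_mul b5'
  have c4 := left_ne_zero_of_mul (right_ne_zero_of_mul b5')
  have d1 := left_ne_zero_of_mul b6
  have d2 := right_ne_zero_of_mul b6
  clear b7 b5' b6
  field_simp
end

section
variable {q a : ℂ} {x : Fin 7 → ℂ} {j : Fin 7}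

/-- The distinguished parameter is the fixed one, so raising the principal series lowers the
complementary one and `downFactor` appears on the right. The product on the left comes from the (x_j
x_i / a)_∞, each of which starts one factor earlier. -/
theorem upFactor_mul_complCoeff_self (hq0 : q ≠ 0) (hq : ‖q‖ < 1)
    (h : PhiNonsingular q a x j) (hp : PhiNonsingular q (a * q ^ 2) (scaleExcept q x j) j) :
    (∏ i ∈ Finset.univ.erase j, (1 - x j / (a * q) * x i)) * upFactor q a x j
        * complCoeff q (a * q ^ 2) (scaleExcept q x j) j
      = complCoeff q a x j * downFactor q (x j ^ 2 / a) (complParams a x j) j := by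
  have ha := h.1
  have hx := h.2.1
  have hxj := hx j
  have e1 : qPochInf q (a * q) = (1 - a * q) * ((1 - a * q ^ 2) * qPochInf q (a * q ^ 2 * q)) := by
    rw [qPochInf_step hq (z := a * q ^ 2) (by ring), qPochInf_eq hq (a * q ^ 2)]
  have e2 : qPochInf q (x j / (a * q ^ 2))
      = (1 - x j / (a * q ^ 2)) * ((1 - x j / (a * q)) * qPochInf q (x j / a)) := by
    rw [← qPochInf_step hq (y := x j / (a * q)) (by field_simp),
      ← qPochInf_step hq (y := x j / (a * q ^ 2)) (by field_simp)]
  have e3 : qPochInf q (x j ^ 2 * q / (a * q ^ 2))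
      = (1 - x j ^ 2 / a / q) * ((1 - x j ^ 2 / a) * qPochInf q (x j ^ 2 * q / a)) := by
    rw [← qPochInf_step hq (y := x j ^ 2 / a) (by ring),
      ← qPochInf_step hq (y := x j ^ 2 / a / q) (by field_simp)]
    congr 1; field_simp
  have e4 : qPochInf q (a / x j)
      = (1 - a / x j) * ((1 - a * q / x j) * qPochInf q (a * q ^ 2 / x j)) := by
    rw [← qPochInf_step hq (y := a * q / x j) (by ring),
      ← qPochInf_step hq (y := a / x j) (by ring)]
  have s1 : ∏ i ∈ Finset.univ.erase j, qPochInf q (x i)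
      = (∏ i ∈ Finset.univ.erase j, (1 - x i)) * ∏ i ∈ Finset.univ.erase j, qPochInf q (x i * q) :=
    prod_qPochInf_step hq fun i => rfl
  have s2 : ∏ i ∈ Finset.univ.erase j, qPochInf q (a * q / x i)
      = (∏ i ∈ Finset.univ.erase j, (1 - a * q / x i))
        * ∏ i ∈ Finset.univ.erase j, qPochInf q (a * q ^ 2 * q / (x i * q)) :=
    prod_qPochInf_step hq fun i => by have := hx i; field_simp
  have s3 : ∏ i ∈ Finset.univ.erase j, qPochInf q (x j * q / (x i * q))
      = (∏ i ∈ Finset.univ.erase j, (1 - x j / x i))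
        * ∏ i ∈ Finset.univ.erase j, qPochInf q (x j * q / x i) := by
    rw [← prod_qPochInf_step hq fun i => show x j / x i * q = x j * q / x i by ring]
    exact Finset.prod_congr rfl fun i _ => by congr 1; have := hx i; field_simp
  have s4 : ∏ i ∈ Finset.univ.erase j, qPochInf q (x j * (x i * q) / (a * q ^ 2))
      = (∏ i ∈ Finset.univ.erase j, (1 - x j / (a * q) * x i))
        * ∏ i ∈ Finset.univ.erase j, qPochInf q (x j * x i / a) := by
    rw [← prod_qPochInf_step hq fun i =>
      show x j / (a * q) * x i * q = x j * x i / a by field_simp]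
    exact Finset.prod_congr rfl fun i _ => by congr 1; field_simp
  have b1 : qPochInf q (x j ^ 2 * q / (a * q ^ 2)) ≠ 0 := by
    have := qPochInf_ne_zero hq hp.2.2.2.2.1
    rwa [scaleExcept_self] at this
  have b2 : qPochInf q (a / x j) ≠ 0 := qPochInf_ne_zero hq h.2.2.2.2.2.1
  have b3 : ∏ i ∈ Finset.univ.erase j, qPochInf q (x j * (x i * q) / (a * q ^ 2)) ≠ 0 := by
    rw [← prod_erase_scaleExcept q x j fun y => qPochInf q (x j * y / (a * q ^ 2))]
    refine prod_qPochInf_ne_zero hq fun i hi => ?_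
    have := hp.2.2.2.2.2.2.2 i (Finset.ne_of_mem_erase hi)
    rwa [scaleExcept_self] at this
  have b4 : ∏ i ∈ Finset.univ.erase j, qPochInf q (a * q / x i) ≠ 0 :=
    prod_qPochInf_ne_zero hq fun i _ => h.vwpRegular.2 i
  have b5 : 1 - a * q ^ 2 / x j ≠ 0 := by
    convert one_sub_mul_pow_ne_zero (h.vwpRegular.2 j) 1 using 1
    ring
  have f1 : 1 - x j / a = -(x j / a) * (1 - a / x j) := by field_simp; ring
  have f2 : 1 - x j / (a * q) = -(x j / (a * q)) * (1 - a * q / x j) := by field_simp; ring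
  have f3 : 1 - x j / (a * q ^ 2) = -(x j / (a * q ^ 2)) * (1 - a * q ^ 2 / x j) := by
    field_simp; ring
  have g1 : ∏ i ∈ Finset.univ.erase j, (1 - x j ^ 2 / a / (x j * x i / a))
      = ∏ i ∈ Finset.univ.erase j, (1 - x j / x i) :=
    Finset.prod_congr rfl fun i _ => by congr 1; have := hx i; field_simp
  rw [complCoeff_eq, complCoeff_eq, downFactor, complParams_self, upFactor,
    prod_erase_scaleExcept q x j fun y => qPochInf q y,
    prod_erase_scaleExcept q x j fun y => qPochInf q (scaleExcept q x j j * q / y),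
    prod_erase_scaleExcept q x j fun y => qPochInf q (a * q ^ 2 * q / y),
    prod_erase_scaleExcept q x j fun y => qPochInf q (scaleExcept q x j j * y / (a * q ^ 2)),
    prod_erase_complParams fun y => 1 - x j ^ 2 / a / y, g1,
    scaleExcept_self, show x j ^ 2 / a / (q * x j) = x j / (a * q) by field_simp,
    show x j ^ 2 / a / x j = x j / a by field_simp]
  rw [e3] at b1 ⊢
  rw [e4] at b2 ⊢
  rw [s4] at b3 ⊢
  rw [s2] at b4 ⊢
  rw [s1, s3, e1, e2, f1, f2, f3]
  clear s1 s2 s3 s4 e1 e2 e3 e4 f1 f2 f3 g1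
  generalize ∏ i ∈ Finset.univ.erase j, qPochInf q (x j * x i / a) = Y1 at *
  generalize ∏ i ∈ Finset.univ.erase j, qPochInf q (x j * q / x i) = Y2 at *
  generalize ∏ i ∈ Finset.univ.erase j, qPochInf q (a * q ^ 2 * q / (x i * q)) = Y3 at *
  generalize ∏ i ∈ Finset.univ.erase j, (1 - a * q / x i) = Y4 at *
  generalize ∏ i ∈ Finset.univ.erase j, qPochInf q (x i * q) = Y5 at *
  generalize ∏ i ∈ Finset.univ.erase j, (1 - x i) = Y6 at *
  generalize ∏ i ∈ Finset.univ.erase j, (1 - x j / (a * q) * x i) = Y7 at *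
  generalize ∏ i ∈ Finset.univ.erase j, (1 - x j / x i) = Y8 at *
  generalize qPochInf q (a * q ^ 2 / x j) = Z1 at *
  generalize 1 - a * q ^ 2 / x j = Z2 at *
  generalize 1 - a * q / x j = Z3 at *
  generalize 1 - a / x j = Z5 at *
  generalize qPochInf q (x j ^ 2 * q / a) = Z8 at *
  generalize 1 - x j ^ 2 / a / q = Z6 at *
  generalize 1 - x j ^ 2 / a = Z7 at *
  have c1 := left_ne_zero_of_mul b1
  have c2 := left_ne_zero_of_mul (right_ne_zero_of_mul b1)
  have c3 := right_ne_zero_of_mul (right_ne_zero_of_mul b1)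
  have c4 := left_ne_zero_of_mul b2
  have c5 := left_ne_zero_of_mul (right_ne_zero_of_mul b2)
  have c6 := right_ne_zero_of_mul (right_ne_zero_of_mul b2)
  have c7 := left_ne_zero_of_mul b3
  have c8 := right_ne_zero_of_mul b3
  have c9 := left_ne_zero_of_mul b4
  have d1 := right_ne_zero_of_mul b4
  clear b1 b2 b3 b4
  field_simp

theorem downFactor_mul_complCoeff_self (hq0 : q ≠ 0) (hq : ‖q‖ < 1) (hAq : 1 - a / q ≠ 0)
    (h : PhiNonsingular q a x j)
    (hm : PhiNonsingular q (a * q⁻¹ ^ 2) (scaleExcept q⁻¹ x j) j) :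
    downFactor q a x j * complCoeff q (a * q⁻¹ ^ 2) (scaleExcept q⁻¹ x j) j
      = complCoeff q a x j * ((∏ i ∈ Finset.univ.erase j, (1 - x i / q))
        * upFactor q (x j ^ 2 / a) (complParams a x j) j) := by
  have ha := h.1
  have hx := h.2.1
  have hxj := hx j
  have hA := h.vwpRegular.one_sub_ne_zero
  have e1 : qPochInf q (a * q⁻¹ ^ 2 * q) = (1 - a / q) * ((1 - a) * qPochInf q (a * q)) := by
    rw [← qPochInf_eq hq a, qPochInf_step hq (z := a) (by field_simp)]
    congr 2; field_simp
  have e2 : qPochInf q (x j / a) = (1 - x j / a)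
      * ((1 - x j * q / a) * qPochInf q (x j / (a * q⁻¹ ^ 2))) := by
    rw [← qPochInf_step hq (y := x j * q / a) (by field_simp),
      ← qPochInf_step hq (y := x j / a) (by ring)]
  have e3 : qPochInf q (x j ^ 2 * q / a) = (1 - x j ^ 2 / a * q)
      * ((1 - x j ^ 2 / a * q ^ 2) * qPochInf q (x j ^ 2 * q / (a * q⁻¹ ^ 2))) := by
    rw [← qPochInf_step hq (y := x j ^ 2 / a * q ^ 2) (by field_simp),
      ← qPochInf_step hq (y := x j ^ 2 / a * q) (by ring)]
    congr 1; ring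
  have e4 : qPochInf q (a * q⁻¹ ^ 2 / x j) = (1 - a / (x j * q ^ 2))
      * ((1 - a / (q * x j)) * qPochInf q (a / x j)) := by
    rw [← qPochInf_step hq (y := a / (q * x j)) (by field_simp),
      ← qPochInf_step hq (y := a / (x j * q ^ 2)) (by field_simp)]
    congr 1; field_simp
  have s1 : ∏ i ∈ Finset.univ.erase j, qPochInf q (x i * q⁻¹)
      = (∏ i ∈ Finset.univ.erase j, (1 - x i / q))
        * ∏ i ∈ Finset.univ.erase j, qPochInf q (x i) := by
    simp only [← div_eq_mul_inv]
    exact prod_qPochInf_step hq fun i => by field_simp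
  have s2 : ∏ i ∈ Finset.univ.erase j, qPochInf q (a * q⁻¹ ^ 2 * q / (x i * q⁻¹))
      = (∏ i ∈ Finset.univ.erase j, (1 - a / x i))
        * ∏ i ∈ Finset.univ.erase j, qPochInf q (a * q / x i) := by
    rw [← prod_qPochInf_step hq fun i => show a / x i * q = a * q / x i by ring]
    exact Finset.prod_congr rfl fun i _ => by congr 1; have := hx i; field_simp
  have s3 : ∏ i ∈ Finset.univ.erase j, qPochInf q (x j * q / x i)
      = (∏ i ∈ Finset.univ.erase j, (1 - x j * q / x i))
        * ∏ i ∈ Finset.univ.erase j, qPochInf q (x j * q / (x i * q⁻¹)) :=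
    prod_qPochInf_step hq fun i => by have := hx i; field_simp
  have s4 : ∏ i ∈ Finset.univ.erase j, qPochInf q (x j * x i / a)
      = (∏ i ∈ Finset.univ.erase j, (1 - x j * x i / a))
        * ∏ i ∈ Finset.univ.erase j, qPochInf q (x j * (x i * q⁻¹) / (a * q⁻¹ ^ 2)) :=
    prod_qPochInf_step hq fun i => by field_simp
  have b1 : qPochInf q (x j ^ 2 * q / a) ≠ 0 := qPochInf_ne_zero hq h.2.2.2.2.1
  have b2 : qPochInf q (a * q⁻¹ ^ 2 / x j) ≠ 0 := by
    have := qPochInf_ne_zero hq hm.2.2.2.2.2.1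
    rwa [scaleExcept_self] at this
  have b2' : 1 - a / x j ≠ 0 := by
    simpa using one_sub_mul_pow_ne_zero h.2.2.2.2.2.1 0
  have b3 : ∏ i ∈ Finset.univ.erase j, qPochInf q (x j * x i / a) ≠ 0 :=
    prod_qPochInf_ne_zero hq fun i hi => h.2.2.2.2.2.2.2 i (Finset.ne_of_mem_erase hi)
  have b4 : ∏ i ∈ Finset.univ.erase j, qPochInf q (a * q⁻¹ ^ 2 * q / (x i * q⁻¹)) ≠ 0 := by
    rw [← prod_erase_scaleExcept q⁻¹ x j fun y => qPochInf q (a * q⁻¹ ^ 2 * q / y)]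
    exact prod_qPochInf_ne_zero hq fun i _ => hm.vwpRegular.2 i
  have b5 : ∏ i ∈ Finset.univ.erase j, qPochInf q (x j * q / x i) ≠ 0 :=
    prod_qPochInf_ne_zero hq fun i hi => h.compl_of_ne (Finset.ne_of_mem_erase hi)
  have b6 : 1 - x j * q / a ≠ 0 := by
    simpa using one_sub_mul_pow_ne_zero h.compl_self 0
  have b7 : 1 - x j * q ^ 2 / a ≠ 0 := by
    convert one_sub_mul_pow_ne_zero h.compl_self 1 using 1
    ring
  have f1 : 1 - x j / a = -(x j / a) * (1 - a / x j) := by field_simp; ring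
  have f2 : 1 - a / (x j * q ^ 2) = -(a / (x j * q ^ 2)) * (1 - x j * q ^ 2 / a) := by
    field_simp; ring
  have g1 : ∏ i ∈ Finset.univ.erase j, (1 - x j ^ 2 / a * q / (x j * x i / a))
      = ∏ i ∈ Finset.univ.erase j, (1 - x j * q / x i) :=
    Finset.prod_congr rfl fun i _ => by congr 1; have := hx i; field_simp
  rw [complCoeff_eq, complCoeff_eq, downFactor, upFactor, complParams_self,
    prod_erase_scaleExcept q⁻¹ x j fun y => qPochInf q y,
    prod_erase_scaleExcept q⁻¹ x j fun y => qPochInf q (scaleExcept q⁻¹ x j j * q / y),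
    prod_erase_scaleExcept q⁻¹ x j fun y => qPochInf q (a * q⁻¹ ^ 2 * q / y),
    prod_erase_scaleExcept q⁻¹ x j fun y => qPochInf q (scaleExcept q⁻¹ x j j * y / (a * q⁻¹ ^ 2)),
    prod_erase_complParams fun y => 1 - x j ^ 2 / a * q / y, prod_erase_complParams fun y => 1 - y,
    g1, scaleExcept_self, show x j ^ 2 / a * q / x j = x j * q / a by field_simp,
    show x j ^ 2 / a * q ^ 2 / x j = x j * q ^ 2 / a by field_simp]
  rw [e3] at b1 ⊢
  rw [e4] at b2 ⊢
  rw [s4] at b3 ⊢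
  rw [s2] at b4 ⊢
  rw [s3] at b5 ⊢
  rw [s1, e1, e2, f1, f2]
  rw [f2] at b2
  clear s1 s2 s3 s4 e1 e2 e3 e4 f1 f2 g1
  generalize ∏ i ∈ Finset.univ.erase j, qPochInf q (x j * (x i * q⁻¹) / (a * q⁻¹ ^ 2)) = Y1 at *
  generalize ∏ i ∈ Finset.univ.erase j, qPochInf q (x j * q / (x i * q⁻¹)) = Y2 at *
  generalize ∏ i ∈ Finset.univ.erase j, qPochInf q (a * q / x i) = Y3 at *
  generalize ∏ i ∈ Finset.univ.erase j, (1 - a / x i) = Y4 at *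
  generalize ∏ i ∈ Finset.univ.erase j, qPochInf q (x i) = Y5 at *
  generalize ∏ i ∈ Finset.univ.erase j, (1 - x i / q) = Y6 at *
  generalize ∏ i ∈ Finset.univ.erase j, (1 - x j * x i / a) = Y7 at *
  generalize ∏ i ∈ Finset.univ.erase j, (1 - x j * q / x i) = Y8 at *
  generalize qPochInf q (a / x j) = Z1 at *
  generalize 1 - x j * q ^ 2 / a = Z2 at *
  generalize 1 - x j * q / a = Z3 at *
  generalize 1 - a / (q * x j) = Z4 at *
  generalize 1 - a / x j = Z5 at *
  generalize qPochInf q (x j ^ 2 * q / (a * q⁻¹ ^ 2)) = Z8 at *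
  generalize qPochInf q (x j / (a * q⁻¹ ^ 2)) = Z9 at *
  generalize 1 - x j ^ 2 / a * q = Z6 at *
  generalize 1 - x j ^ 2 / a * q ^ 2 = Z7 at *
  generalize 1 - a / q = W1 at *
  generalize 1 - a = W2 at *
  have c1 := left_ne_zero_of_mul b1
  have c2 := left_ne_zero_of_mul (right_ne_zero_of_mul b1)
  have c3 := right_ne_zero_of_mul (right_ne_zero_of_mul b1)
  have c5 := left_ne_zero_of_mul (right_ne_zero_of_mul b2)
  have c6 := right_ne_zero_of_mul (right_ne_zero_of_mul b2)
  have c7 := left_ne_zero_of_mul b3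
  have c8 := right_ne_zero_of_mul b3
  have c9 := left_ne_zero_of_mul b4
  have d1 := right_ne_zero_of_mul b4
  have d2 := left_ne_zero_of_mul b5
  have d3 := right_ne_zero_of_mul b5
  clear b1 b2 b3 b4 b5
  field_simp
end

/-! ### Relations for the principal and complementary series, and for Φ -/

section
variable {q a : ℂ} {x : Fin 7 → ℂ} {p : Fin 7}

theorem PhiNonsingular.Phi_eq (h : PhiNonsingular q a x p) :
    Phi q a x p = (∑' n, vwpTerm q a x n)
      + complCoeff q a x p * ∑' n, vwpTerm q (x p ^ 2 / a) (complParams a x p) n := by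
  rw [Phi, W10_eq_tsum h.2.2.1, W10_eq_tsum h.2.2.2.1]

theorem tsum_principal (hq0 : q ≠ 0) (hq : ‖q‖ < 1) (hbal : ∏ i, x i = a ^ 3 * q ^ 2)
    (hAq : 1 - a / q ≠ 0) (h : PhiNonsingular q a x p)
    (hp : PhiNonsingular q (a * q ^ 2) (scaleExcept q x 5) p)
    (hm : PhiNonsingular q (a * q⁻¹ ^ 2) (scaleExcept q⁻¹ x 5) p) :
    certA q a x * (∏ i ∈ Finset.univ.erase 5, (1 - x 5 / (a * q) * x i)) * upFactor q a x 5
        * (∑' n, vwpTerm q (a * q ^ 2) (scaleExcept q x 5) n)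
      + certB q a x * downFactor q a x 5
        * (∑' n, vwpTerm q (a * q⁻¹ ^ 2) (scaleExcept q⁻¹ x 5) n)
      + certG q a x * (∑' n, vwpTerm q a x n)
      = certS q a x * (1 - x 5 / q) * vwpLimit q a x :=
  tsum_vwpTerm_scaleExcept hq0 hq h.2.1 hAq h.vwpRegular hp.vwpRegular hm.vwpRegular
    (certificate hq0 h.1 h.2.1 hbal) (certificate_one hq0 h.1 h.2.1 hbal)
    (by rw [certB, certS, mul_comm (x 5) q]; ring)

/-- The certificate evaluated at t·x_p/a is the pair certificate for the complementary parameters: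
the index p contributes 1 - tA with A = x_p²/a. The factor a/x_p in the boundary term compensates
for the prefactor t of the certificate. -/
theorem tsum_complementary_of_ne (hq0 : q ≠ 0) (hq : ‖q‖ < 1) (hbal : ∏ i, x i = a ^ 3 * q ^ 2)
    (hp5 : p ≠ 5) (h : PhiNonsingular q a x p)
    (hp : PhiNonsingular q (a * q ^ 2) (scaleExcept q x 5) p)
    (hm : PhiNonsingular q (a * q⁻¹ ^ 2) (scaleExcept q⁻¹ x 5) p)
    (hw : 1 - x p * x 5 / (a * q) ≠ 0) :
    certA q a x * (∏ i ∈ Finset.univ.erase 5, (1 - x 5 / (a * q) * x i))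
          / (1 - x p * x 5 / (a * q))
          * pairFactor q (x p ^ 2 / a) (complParams a x p) p 5
        * (∑' n, vwpTerm q (x p ^ 2 / a) (shiftPair q (complParams a x p) p 5) n)
      + certB q a x * (∏ i ∈ (Finset.univ.erase 5).erase p, (1 - x i / q))
          * pairFactor q (x p ^ 2 / a) (complParams a x p) 5 p
        * (∑' n, vwpTerm q (x p ^ 2 / a) (shiftPair q (complParams a x p) 5 p) n)
      + certG q a x * (∑' n, vwpTerm q (x p ^ 2 / a) (complParams a x p) n)
      = certS q a x * (1 - x 5 / q) * (a / x p)
        * vwpLimit q (x p ^ 2 / a) (complParams a x p) := by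
  have ha := h.1
  have hx := h.2.1
  have hxp := hx p
  have hx5 := hx 5
  have hX : ∀ i, complParams a x p i ≠ 0 := fun i => by
    by_cases hi : i = p
    · rw [hi, complParams_self]; exact hxp
    · rw [complParams_of_ne hi]; exact div_ne_zero (mul_ne_zero hxp (hx i)) ha
  have hrp := hp.vwpRegular_compl
  have hrm := hm.vwpRegular_compl
  rw [complParams_scaleExcept hq0 hp5, scaleExcept_of_ne _ hp5,
    show (x p * q) ^ 2 / (a * q ^ 2) = x p ^ 2 / a by field_simp] at hrp
  rw [complParams_scaleExcept (inv_ne_zero hq0) hp5, shiftPair_inv _ _ hp5, scaleExcept_of_ne _ hp5,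
    show (x p * q⁻¹) ^ 2 / (a * q⁻¹ ^ 2) = x p ^ 2 / a by field_simp] at hrm
  have hm5 : p ∈ Finset.univ.erase 5 := Finset.mem_erase.2 ⟨hp5, Finset.mem_univ p⟩
  have g1 : ∀ t : ℂ, ∏ i ∈ (Finset.univ.erase 5).erase p, (1 - t * complParams a x p i)
      = ∏ i ∈ (Finset.univ.erase 5).erase p, (1 - t * (x p / a) * x i) := fun t => by
    rw [prod_erase_erase_complParams fun y => 1 - t * y]
    exact Finset.prod_congr rfl fun i _ => by ring
  have g2 : ∀ t : ℂ, ∏ i ∈ (Finset.univ.erase 5).erase p, (1 - t * (x p ^ 2 / a / complParams a x p i))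
      = ∏ i ∈ (Finset.univ.erase 5).erase p, (1 - t * (x p / a) * (a / x i)) := fun t => by
    rw [prod_erase_erase_complParams fun y => 1 - t * (x p ^ 2 / a / y)]
    exact Finset.prod_congr rfl fun i _ => by have := hx i; congr 1; field_simp
  have hw' : x p * x 5 / a / q = x p * x 5 / (a * q) := by field_simp
  have hk : a / x p * (x p / a) = 1 := by field_simp
  refine tsum_vwpTerm_shiftPair hp5 hq0 hq hX h.vwpRegular_compl hrp hrm ?_ ?_
  · intro t
    rw [g1, g2, complParams_self, complParams_of_ne hp5.symm]
    have c := certificate hq0 ha hx hbal (t * (x p / a))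
    rw [← Finset.mul_prod_erase _ _ hm5, ← Finset.mul_prod_erase _ (fun i =>
      1 - t * (x p / a) * (a / x i)) hm5, ← Finset.mul_prod_erase _ (fun i => 1 - x i / q) hm5] at c
    rw [hw', div_mul_cancel₀ _ hw, show x p ^ 2 / a * q / x p = x p / a * q by field_simp,
      show x p ^ 2 / a * q / (x p * x 5 / a) = x p * q / x 5 by field_simp,
      show t * (x p ^ 2 / a) / x p = t * (x p / a) by field_simp,
      show t * (x p ^ 2 / a) / (x p * x 5 / a) = t * x p / x 5 by field_simp,
      show t * (x p * x 5 / a) = t * (x p / a) * x 5 by ring,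
      show t * (x p ^ 2 / a) = t * (x p / a) * x p by ring,
      show x p ^ 2 / a * t ^ 2 = a * (t * (x p / a)) ^ 2 by field_simp]
    rw [show t * (x p / a) * (a / x p) = t by field_simp,
      show t * (x p / a) * a = t * x p by field_simp,
      show t * (x p / a) * (a * q / x 5) = t * (x p * q / x 5) by field_simp,
      mul_assoc t (x p / a) q] at c
    linear_combination (a / x p) * c + t * (1 - a * (t * (x p / a)) ^ 2)
      * (certA q a x * (∏ i ∈ Finset.univ.erase 5, (1 - x 5 / (a * q) * x i))
          * ((1 - t * (x p / a)) * (1 - t * x p) * (1 - t * (x p / a * q)) * (1 - t * x p / q))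
        + certB q a x * ((1 - x p / q) * ∏ i ∈ (Finset.univ.erase 5).erase p, (1 - x i / q))
          * ((1 - t * x p / x 5) * (1 - t * (x p / a) * x 5) * (1 - t * (x p * q / x 5))
            * (1 - t * (x p / a) * x 5 / q))
        + certG q a x * ((1 - t * (x p / a) * x 5 / q) * (1 - t * x p / q)
          * (1 - t * (x p / a * q)) * (1 - t * (x p * q / x 5)))) * hk
  · have c := certificate_other hq0 ha hx hbal hp5
    have g3 := g1 1
    simp only [one_mul] at g3
    rw [g3, complParams_self, complParams_of_ne hp5.symm,
      show x p ^ 2 / a * q / x p = q * x p / a by field_simp,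
      show x p ^ 2 / a * q / (x p * x 5 / a) = x p * q / x 5 by field_simp,
      show x p ^ 2 / a / x p = x p / a by field_simp,
      show x p ^ 2 / a / (x p * x 5 / a) = x p / x 5 by field_simp]
    -- The α of the pair relation has the denominator 1 - x_p x_5/(aq), which `certificate_other`
    -- keeps as a factor.
    refine mul_right_cancel₀ hw ?_
    generalize certA q a x * (∏ i ∈ Finset.univ.erase 5, (1 - x 5 / (a * q) * x i)) = Y1 at *
    have hY : Y1 / (1 - x p * x 5 / (a * q)) * (1 - x p * x 5 / (a * q)) = Y1 :=
      div_mul_cancel₀ _ hw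
    linear_combination (a / x p) * c
      + ((1 - x p / a) * (1 - x p) * (1 - q * x p / a)) * (Y1 * hk - hY)
      + (certB q a x * (∏ i ∈ (Finset.univ.erase 5).erase p, (1 - x i / q))
          * ((1 - x p / x 5) * (1 - x p * x 5 / a) * (1 - x p * q / x 5)
            * (1 - x p * x 5 / (a * q)))
        + certG q a x * ((1 - x p * q / x 5) * (1 - x p * x 5 / (a * q)) * (1 - q * x p / a))) * hk

theorem tsum_complementary_five (hq0 : q ≠ 0) (hq : ‖q‖ < 1) (hbal : ∏ i, x i = a ^ 3 * q ^ 2)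
    (h : PhiNonsingular q a x 5)
    (hp : PhiNonsingular q (a * q ^ 2) (scaleExcept q x 5) 5)
    (hm : PhiNonsingular q (a * q⁻¹ ^ 2) (scaleExcept q⁻¹ x 5) 5) :
    certB q a x * (∏ i ∈ Finset.univ.erase 5, (1 - x i / q))
          * upFactor q (x 5 ^ 2 / a) (complParams a x 5) 5
        * (∑' n, vwpTerm q (x 5 ^ 2 / a * q ^ 2) (scaleExcept q (complParams a x 5) 5) n)
      + certA q a x * downFactor q (x 5 ^ 2 / a) (complParams a x 5) 5
        * (∑' n, vwpTerm q (x 5 ^ 2 / a * q⁻¹ ^ 2) (scaleExcept q⁻¹ (complParams a x 5) 5) n)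
      + certG q a x * (∑' n, vwpTerm q (x 5 ^ 2 / a) (complParams a x 5) n)
      = certS q a x * (a / x 5) * (1 - x 5 / q)
        * vwpLimit q (x 5 ^ 2 / a) (complParams a x 5) := by
  have ha := h.1
  have hx := h.2.1
  have hx5 := hx 5
  have hX : ∀ i, complParams a x 5 i ≠ 0 := fun i => by
    by_cases hi : i = 5
    · rw [hi, complParams_self]; exact hx5
    · rw [complParams_of_ne hi]; exact div_ne_zero (mul_ne_zero hx5 (hx i)) ha
  have hrp := hp.vwpRegular_compl
  have hrm := hm.vwpRegular_compl
  rw [complParams_scaleExcept_self hq0, scaleExcept_self,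
    show x 5 ^ 2 / (a * q ^ 2) = x 5 ^ 2 / a * q⁻¹ ^ 2 by field_simp] at hrp
  rw [complParams_scaleExcept_self (inv_ne_zero hq0), scaleExcept_self, inv_inv,
    show x 5 ^ 2 / (a * q⁻¹ ^ 2) = x 5 ^ 2 / a * q ^ 2 by field_simp] at hrm
  -- This is the leading factor of the product (x_5² q / (aq²))_∞ in the denominator of the
  -- coefficient for Φ₊.
  have hAq : 1 - x 5 ^ 2 / a / q ≠ 0 := by
    have := one_sub_mul_pow_ne_zero hp.2.2.2.2.1 0
    rw [scaleExcept_self] at this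
    convert this using 2
    field_simp
  have g1 : ∀ t : ℂ, ∏ i ∈ Finset.univ.erase 5, (1 - t * complParams a x 5 i)
      = ∏ i ∈ Finset.univ.erase 5, (1 - t * (x 5 / a) * x i) := fun t => by
    rw [prod_erase_complParams fun y => 1 - t * y]
    exact Finset.prod_congr rfl fun i _ => by ring
  have g2 : ∀ t : ℂ, ∏ i ∈ Finset.univ.erase 5, (1 - t * (x 5 ^ 2 / a / complParams a x 5 i))
      = ∏ i ∈ Finset.univ.erase 5, (1 - t * (x 5 / a) * (a / x i)) := fun t => by
    rw [prod_erase_complParams fun y => 1 - t * (x 5 ^ 2 / a / y)]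
    exact Finset.prod_congr rfl fun i _ => by have := hx i; congr 1; field_simp
  have g3 : ∏ i ∈ Finset.univ.erase 5, (1 - complParams a x 5 i / q)
      = ∏ i ∈ Finset.univ.erase 5, (1 - x 5 / (a * q) * x i) := by
    rw [prod_erase_complParams fun y => 1 - y / q]
    exact Finset.prod_congr rfl fun i _ => by congr 1; field_simp
  have hk : a / x 5 * (x 5 / a) = 1 := by field_simp
  -- Raised and lowered data exchange places: the raised complementary series belongs to Φ₋ and the
  -- lowered one to Φ₊. Correspondingly `certB` with its product acts as α and `certA` as β.
  refine tsum_vwpTerm_scaleExcept hq0 hq hX hAq h.vwpRegular_compl hrm hrp ?_ ?_ ?_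
  · intro t
    rw [g1, g2, g3, complParams_self]
    have c := certificate hq0 ha hx hbal (t * (x 5 / a))
    rw [show x 5 ^ 2 / a * q / x 5 = x 5 / a * q by field_simp,
      show t * (x 5 ^ 2 / a) / x 5 = t * (x 5 / a) by field_simp,
      show t * (x 5 ^ 2 / a) = t * (x 5 / a) * x 5 by ring,
      show x 5 ^ 2 / a * t ^ 2 = a * (t * (x 5 / a)) ^ 2 by field_simp]
    rw [show t * (x 5 / a) * a = t * x 5 by field_simp,
      show t * (x 5 / a) * (a * q / x 5) = t * q by field_simp,
      mul_assoc t (x 5 / a) q, mul_div_cancel_right₀ t hx5] at c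
    linear_combination (a / x 5) * c + t * (1 - a * (t * (x 5 / a)) ^ 2)
      * (certA q a x * (∏ i ∈ Finset.univ.erase 5, (1 - x 5 / (a * q) * x i))
          * ((1 - t * (x 5 / a)) * (1 - t * x 5) * (1 - t * (x 5 / a * q)) * (1 - t * x 5 / q))
        + certB q a x * (∏ i ∈ Finset.univ.erase 5, (1 - x i / q))
          * ((1 - t) * (1 - t * (x 5 / a) * x 5) * (1 - t * q) * (1 - t * (x 5 / a) * x 5 / q))
        + certG q a x * ((1 - t * (x 5 / a) * x 5 / q) * (1 - t * x 5 / q)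
          * (1 - t * (x 5 / a * q)) * (1 - t * q))) * hk
  · have c := certificate_five hq0 ha hx hbal
    have g4 := g1 1
    simp only [one_mul] at g4
    have g5 := g2 1
    simp only [one_mul] at g5
    rw [g3, g4, g5, complParams_self,
      show x 5 ^ 2 / a * q / x 5 = x 5 * q / a by field_simp,
      show x 5 ^ 2 / a / x 5 = x 5 / a by field_simp,
      show x 5 ^ 2 / a / q = x 5 ^ 2 / (a * q) by field_simp,
      Finset.prod_congr rfl fun i _ => show 1 - x 5 / a * (a / x i) = 1 - x 5 / x i by
        have := hx i; congr 1; field_simp]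
    linear_combination (a / x 5) * c + (1 - x 5 ^ 2 / a)
      * (certA q a x * (∏ i ∈ Finset.univ.erase 5, (1 - x 5 / (a * q) * x i))
          * ((1 - x 5 / a) * (1 - x 5) * (1 - x 5 * q / a))
        + certG q a x * ((1 - x 5 * q / a) * (1 - q) * (1 - x 5 ^ 2 / (a * q)))) * hk
  · rw [complParams_self, certA, certS]
    field_simp
    ring

/-- The contiguous relation for the complementary pair, with coefficients normalised by the
certificate. -/
theorem Phi_contiguous (hq0 : q ≠ 0) (hq : ‖q‖ < 1) (hbal : ∏ i, x i = a ^ 3 * q ^ 2)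
    (hAq : 1 - a / q ≠ 0) (h : PhiNonsingular q a x p)
    (hp : PhiNonsingular q (a * q ^ 2) (scaleExcept q x 5) p)
    (hm : PhiNonsingular q (a * q⁻¹ ^ 2) (scaleExcept q⁻¹ x 5) p) :
    certA q a x * (∏ i ∈ Finset.univ.erase 5, (1 - x 5 / (a * q) * x i)) * upFactor q a x 5
        * Phi q (a * q ^ 2) (scaleExcept q x 5) p
      + certB q a x * downFactor q a x 5 * Phi q (a * q⁻¹ ^ 2) (scaleExcept q⁻¹ x 5) p
      + certG q a x * Phi q a x p = 0 := by
  have ha := h.1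
  have hxp := h.2.1 p
  have r1 := tsum_principal hq0 hq hbal hAq h hp hm
  have l := complCoeff_mul_vwpLimit hq h
  have hk : a / x p * (x p / a) = 1 := by field_simp
  -- The complementary relation is multiplied by `complCoeff`, which the shift lemmas carry into the
  -- coefficients for Φ₊ and Φ₋; the boundary terms then cancel.
  rw [h.Phi_eq, hp.Phi_eq, hm.Phi_eq]
  by_cases hp5 : p = 5
  · subst hp5
    have r2 := tsum_complementary_five hq0 hq hbal h hp hm
    have u := upFactor_mul_complCoeff_self hq0 hq h hp
    have d := downFactor_mul_complCoeff_self hq0 hq hAq h hm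
    rw [complParams_scaleExcept_self hq0, complParams_scaleExcept_self (inv_ne_zero hq0), inv_inv,
      scaleExcept_self, scaleExcept_self,
      show x 5 ^ 2 / (a * q ^ 2) = x 5 ^ 2 / a * q⁻¹ ^ 2 by field_simp,
      show x 5 ^ 2 / (a * q⁻¹ ^ 2) = x 5 ^ 2 / a * q ^ 2 by field_simp]
    linear_combination r1 + complCoeff q a x 5 * r2 + certS q a x * (1 - x 5 / q) * (a / x 5) * l
      - certS q a x * (1 - x 5 / q) * vwpLimit q a x * hk
      + certA q a x
        * (∑' n, vwpTerm q (x 5 ^ 2 / a * q⁻¹ ^ 2) (scaleExcept q⁻¹ (complParams a x 5) 5) n) * u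
      + certB q a x
        * (∑' n, vwpTerm q (x 5 ^ 2 / a * q ^ 2) (scaleExcept q (complParams a x 5) 5) n) * d
  · have hw : 1 - x p * x 5 / (a * q) ≠ 0 := by
      have := one_sub_mul_pow_ne_zero (hp.2.2.2.2.2.2.2 5 (Ne.symm hp5)) 0
      rw [scaleExcept_self, scaleExcept_of_ne q hp5] at this
      convert this using 2
      field_simp
    have r2 := tsum_complementary_of_ne hq0 hq hbal hp5 h hp hm hw
    have u := upFactor_mul_complCoeff hq0 hq hp5 h hp
    have d := downFactor_mul_complCoeff hq0 hq hp5 hAq h hm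
    rw [complParams_scaleExcept hq0 hp5, complParams_scaleExcept (inv_ne_zero hq0) hp5,
      shiftPair_inv _ _ hp5, scaleExcept_of_ne _ hp5, scaleExcept_of_ne _ hp5,
      show (x p * q) ^ 2 / (a * q ^ 2) = x p ^ 2 / a by field_simp,
      show (x p * q⁻¹) ^ 2 / (a * q⁻¹ ^ 2) = x p ^ 2 / a by field_simp]
    rw [← eq_div_iff hw] at u
    linear_combination r1 + complCoeff q a x p * r2 + certS q a x * (1 - x 5 / q) * (a / x p) * l
      - certS q a x * (1 - x 5 / q) * vwpLimit q a x * hk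
      + certA q a x * (∏ i ∈ Finset.univ.erase 5, (1 - x 5 / (a * q) * x i))
        * (∑' n, vwpTerm q (x p ^ 2 / a) (shiftPair q (complParams a x p) p 5) n) * u
      + certB q a x
        * (∑' n, vwpTerm q (x p ^ 2 / a) (shiftPair q (complParams a x p) 5 p) n) * d
end

/-! ### Identification of the coefficients -/

section
variable {K : Type*} [Field K]

/-- The stated coefficients are those of the certificate times w/k up to sign, with w = 1 - aq/h and
k = 1 - a/(gq). Only k has to be nonzero. -/
theorem eq_zero_of_mul_eq {X Y Z P P' P₀ U D G k w : K} (hk : k ≠ 0) (hX : X * k = w * U)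
    (hY : Y * k = -w * D) (hZ : Z * k = -w * G) (h : U * P + D * P' + G * P₀ = 0) :
    X * P - Y * P' - Z * P₀ = 0 := by
  refine (mul_eq_zero_iff_right hk).1 ?_
  linear_combination P * hX - P' * hY - P₀ * hZ + w * h

/-- Reversing each of the five factors produces a monomial in which b, …, f occur only through their
product, and balancing then eliminates h. -/
theorem raised_coeff_eq {a q b c d e f g h : K} (ha : a ≠ 0) (hq : q ≠ 0) (hb : b ≠ 0)
    (hc : c ≠ 0) (hd : d ≠ 0) (he : e ≠ 0) (hf : f ≠ 0) (hg : g ≠ 0)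
    (hbal : b * c * d * e * f * g * h = a ^ 3 * q ^ 2) :
    a * g * q / h * ((1 - a * q / (g * b)) * (1 - a * q / (g * c)) * (1 - a * q / (g * d))
      * (1 - a * q / (g * e)) * (1 - a * q / (g * f)))
      = -(a ^ 3 * q ^ 3 / g ^ 3) * q * ((1 - g / (a * q) * b) * (1 - g / (a * q) * c)
        * (1 - g / (a * q) * d) * (1 - g / (a * q) * e) * (1 - g / (a * q) * f)) := by
  have h1 : ∀ y : K, y ≠ 0 → 1 - a * q / (g * y) = -(a * q / (g * y)) * (1 - g / (a * q) * y) :=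
    fun y hy => by field_simp; ring
  have hh' : h = a ^ 3 * q ^ 2 / (b * c * d * e * f * g) := by
    rw [eq_div_iff (by simp [hb, hc, hd, he, hf, hg])]; linear_combination hbal
  rw [h1 b hb, h1 c hc, h1 d hd, h1 e he, h1 f hf, hh']
  field_simp
end

section
variable {q a b c d e f g h : ℂ}

theorem prod_erase_five_eq (F : Fin 7 → ℂ) :
    ∏ i ∈ Finset.univ.erase 5, F i = F 0 * F 1 * F 2 * F 3 * F 4 * F 6 := by
  rw [show Finset.univ.erase (5 : Fin 7) = {0, 1, 2, 3, 4, 6} by decide]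
  simp [mul_assoc]

theorem prod_erase_five_six_eq (F : Fin 7 → ℂ) :
    ∏ i ∈ (Finset.univ.erase 5).erase 6, F i = F 0 * F 1 * F 2 * F 3 * F 4 := by
  rw [show (Finset.univ.erase (5 : Fin 7)).erase 6 = {0, 1, 2, 3, 4} by decide]
  simp [mul_assoc]

/-- The factor 1 - aq/h on the right cancels against the denominator of `upFactor`, whose product
runs over h as well. -/
theorem raised_coeff_mul (ha : a ≠ 0) (hq0 : q ≠ 0) (hb : b ≠ 0) (hc : c ≠ 0) (hd : d ≠ 0)
    (he : e ≠ 0) (hf : f ≠ 0) (hg : g ≠ 0) (hbal : b * c * d * e * f * g * h = a ^ 3 * q ^ 2)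
    (g1 : 1 - a * q / b ≠ 0) (g2 : 1 - a * q / c ≠ 0) (g3 : 1 - a * q / d ≠ 0)
    (g4 : 1 - a * q / e ≠ 0) (g5 : 1 - a * q / f ≠ 0) (g6 : 1 - a * q / g ≠ 0)
    (g7 : 1 - a * q / h ≠ 0) (g8 : 1 - a * q ^ 2 / g ≠ 0) :
    a * g * q / h
        * (((1 - a * q) * (1 - a * q ^ 2)
            * (1 - a * q / (g * b)) * (1 - a * q / (g * c)) * (1 - a * q / (g * d))
            * (1 - a * q / (g * e)) * (1 - a * q / (g * f)))
          / ((1 - a * q / g) * (1 - a * q ^ 2 / g)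
            * (1 - a * q / b) * (1 - a * q / c) * (1 - a * q / d)
            * (1 - a * q / e) * (1 - a * q / f)))
        * (1 - g * h / (a * q)) * (1 - h)
        * (1 - b) * (1 - c) * (1 - d) * (1 - e) * (1 - f) * (1 - a / (g * q))
      = (1 - a * q / h) * (certA q a ![b, c, d, e, f, g, h]
        * (∏ i ∈ Finset.univ.erase 5, (1 - g / (a * q) * (![b, c, d, e, f, g, h] : Fin 7 → ℂ) i))
        * upFactor q a ![b, c, d, e, f, g, h] 5) := by
  have hplusc := raised_coeff_eq ha hq0 hb hc hd he hf hg hbal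
  rw [certA, upFactor, prod_erase_five_eq, prod_erase_five_eq, prod_erase_five_eq]
  change _ = (1 - a * q / h) * (-(a ^ 3 * q ^ 3 / g ^ 3) * (1 - a / (g * q))
    * ((1 - g / (a * q) * b) * (1 - g / (a * q) * c) * (1 - g / (a * q) * d)
      * (1 - g / (a * q) * e) * (1 - g / (a * q) * f) * (1 - g / (a * q) * h))
    * (q * ((1 - a * q) * (1 - a * q ^ 2) * ((1 - b) * (1 - c) * (1 - d) * (1 - e) * (1 - f)
      * (1 - h))) / ((1 - a * q / g) * (1 - a * q ^ 2 / g) * ((1 - a * q / b) * (1 - a * q / c)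
      * (1 - a * q / d) * (1 - a * q / e) * (1 - a * q / f) * (1 - a * q / h)))))
  rw [show g * h / (a * q) = g / (a * q) * h by ring]
  clear * - hplusc g1 g2 g3 g4 g5 g6 g7 g8
  generalize 1 - a * q / b = G1 at *
  generalize 1 - a * q / c = G2 at *
  generalize 1 - a * q / d = G3 at *
  generalize 1 - a * q / e = G4 at *
  generalize 1 - a * q / f = G5 at *
  generalize 1 - a * q / g = G6 at *
  generalize 1 - a * q / h = G7 at *
  generalize 1 - a * q ^ 2 / g = G8 at *
  generalize 1 - a / (g * q) = G9 at *
  generalize -(a ^ 3 * q ^ 3 / g ^ 3) = k at *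
  generalize a * g * q / h = k' at *
  generalize 1 - a * q / (g * b) = H1 at *
  generalize 1 - a * q / (g * c) = H2 at *
  generalize 1 - a * q / (g * d) = H3 at *
  generalize 1 - a * q / (g * e) = H4 at *
  generalize 1 - a * q / (g * f) = H5 at *
  generalize 1 - g / (a * q) * b = J1 at *
  generalize 1 - g / (a * q) * c = J2 at *
  generalize 1 - g / (a * q) * d = J3 at *
  generalize 1 - g / (a * q) * e = J4 at *
  generalize 1 - g / (a * q) * f = J5 at *
  generalize 1 - g / (a * q) * h = J6 at *
  generalize 1 - b = L1 at *
  generalize 1 - c = L2 at *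
  generalize 1 - d = L3 at *
  generalize 1 - e = L4 at *
  generalize 1 - f = L5 at *
  generalize 1 - h = L6 at *
  generalize 1 - a * q = L7 at *
  generalize 1 - a * q ^ 2 = L8 at *
  field_simp
  linear_combination (L1 * L2 * L3 * L4 * L5 * L6 * L7 * L8 * G9 * J6) * hplusc

theorem lowered_coeff_mul (hq0 : q ≠ 0) (hA1 : 1 - a ≠ 0) (hAq : 1 - a / q ≠ 0) :
    (q * (1 - a / g) * (1 - a * q / g) * (1 - a / h) * (1 - a * q / h)
            * (1 - a / b) * (1 - a / c) * (1 - a / d) * (1 - a / e) * (1 - a / f))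
          / ((1 - a / q) * (1 - a)) * (1 - a / (g * q))
      = -(1 - a * q / h) * (certB q a ![b, c, d, e, f, g, h]
        * downFactor q a ![b, c, d, e, f, g, h] 5) := by
  rw [certB, downFactor, prod_erase_five_eq]
  change _ = -(1 - a * q / h) * (-q ^ 2 * (1 - a * q / g) * ((1 - a / (q * g)) * (1 - a / g)
    * ((1 - a / b) * (1 - a / c) * (1 - a / d) * (1 - a / e) * (1 - a / f) * (1 - a / h))
    / (q * (1 - a) * (1 - a / q))))
  rw [mul_comm q g]
  generalize 1 - a * q / h = G1 at *
  generalize 1 - a * q / g = G2 at *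
  generalize 1 - a / (g * q) = G3 at *
  generalize 1 - a / g = G4 at *
  generalize 1 - a / h = G5 at *
  generalize 1 - a / q = G6 at *
  generalize 1 - a = G7 at *
  generalize 1 - a / b = L0 at *
  generalize 1 - a / c = L1 at *
  generalize 1 - a / d = L2 at *
  generalize 1 - a / e = L3 at *
  generalize 1 - a / f = L4 at *
  field_simp

theorem middle_coeff_mul (ha : a ≠ 0) (hq0 : q ≠ 0)
    (hx : ∀ i, (![b, c, d, e, f, g, h] : Fin 7 → ℂ) i ≠ 0)
    (hbal : b * c * d * e * f * g * h = a ^ 3 * q ^ 2) (hgh : h ≠ g * q) (hag' : g * q - a ≠ 0) :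
    (a * q / h * (1 - h / g) * (1 - g * h / (a * q))
            * (1 - b) * (1 - c) * (1 - d) * (1 - e) * (1 - f)
          + g ^ 2 * q ^ 2 / h
            * (((1 - a * q / g) * (1 - a / h) * (1 - a * q / h) * (1 - h / q)
                * (1 - a / (g * b)) * (1 - a / (g * c)) * (1 - a / (g * d))
                * (1 - a / (g * e)) * (1 - a / (g * f)))
              / ((1 - g * q / h) * (1 - a / (g * q))))
          - (h * (1 - g) * (1 - a / g) * (1 - a * q / g)
              * (1 - a * q / (h * b)) * (1 - a * q / (h * c)) * (1 - a * q / (h * d))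
              * (1 - a * q / (h * e)) * (1 - a * q / (h * f)))
            / (1 - g * q / h))
        * (1 - a / (g * q)) = -(1 - a * q / h) * certG q a ![b, c, d, e, f, g, h] := by
  set x : Fin 7 → ℂ := ![b, c, d, e, f, g, h] with hxdef
  have hg : g ≠ 0 := hx 5
  have hh : h ≠ 0 := hx 6
  have h6 : (6 : Fin 7) ∈ Finset.univ.erase 5 := by decide
  obtain ⟨e₁, e₂, e₃, e₄, e₅, h5, h1, h45, hE, hE'⟩ :=
    exists_esymm_erase hx (show (6 : Fin 7) ≠ 5 by decide)
  have he5 : e₅ = a ^ 3 * q ^ 2 / (g * h) := by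
    rw [h5, prod_erase_five_six_eq, ← hbal]
    change b * c * d * e * f = _
    field_simp
  have hB : ∏ i ∈ (Finset.univ.erase 5).erase 6, (1 - x i / q)
      = ∏ i ∈ (Finset.univ.erase 5).erase 6, (1 - 1 / q * x i) :=
    Finset.prod_congr rfl fun i _ => by ring
  have hgamma := middle_coeff_of_esymm (S := certS q a x * (1 - g / q))
    (α := certA q a x * ∏ i ∈ Finset.univ.erase 5, (1 - x 5 / (a * q) * x i))
    (β := certB q a x * ∏ i ∈ Finset.univ.erase 5, (1 - x i / q)) (γ := certG q a x)
    ha hq0 hg hh (sub_ne_zero.2 hgh) hag' he5 hE hE'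
    (by rw [certS, show x 5 = g from rfl]; ring)
    (by rw [certA, ← Finset.mul_prod_erase _ _ h6, show x 5 = g from rfl,
          show x 6 = h from rfl]; ring)
    (by rw [← Finset.mul_prod_erase _ _ h6, hB, certB, show x 5 = g from rfl,
          show x 6 = h from rfl]; ring)
    (by rw [certG, ← Finset.add_sum_erase _ _ h6, ← Finset.add_sum_erase _ _ h6, ← h1, ← h45,
          show x 5 = g from rfl, show x 6 = h from rfl]; ring)
  simp only [prod_erase_five_six_eq] at hgamma
  change (a * q / h * (1 - h / g) * (1 - g * h / (a * q)) * ((1 - 1 * b) * (1 - 1 * c) * (1 - 1 * d)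
    * (1 - 1 * e) * (1 - 1 * f)) + g ^ 2 * q ^ 2 / h * (((1 - a * q / g) * (1 - a / h)
    * (1 - a * q / h) * (1 - h / q) * ((1 - a / g / b) * (1 - a / g / c) * (1 - a / g / d)
    * (1 - a / g / e) * (1 - a / g / f))) / ((1 - g * q / h) * (1 - a / (g * q))))
    - (h * (1 - g) * (1 - a / g) * (1 - a * q / g) * ((1 - a * q / h / b) * (1 - a * q / h / c)
    * (1 - a * q / h / d) * (1 - a * q / h / e) * (1 - a * q / h / f))) / (1 - g * q / h))
    * (1 - a / (g * q)) = -(1 - a * q / h) * certG q a x at hgamma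
  simp only [one_mul, div_div, ← mul_assoc] at hgamma
  exact hgamma
end

end

/-- The seven choices of `p` are the seven choices of the distinguished parameter. The three
functions below are `Φ`, `Φ₊(g-)` and `Φ₋(g+)`: under `+` the parameter `a` is multiplied by `q²`
and the others by `q`, and then `g-` turns `gq` back into `g`; likewise for `Φ₋(g+)`. -/
theorem theorem2p5 (q a b c d e f g h : ℂ) (hq0 : q ≠ 0) (hq1 : ‖q‖ < 1)
    (hbal : b * c * d * e * f * g * h = a ^ 3 * q ^ 2)
    (p : Fin 7)
    (hns : PhiNonsingular q a ![b, c, d, e, f, g, h] p)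
    (hnsPlus : PhiNonsingular q (a * q ^ 2) ![b * q, c * q, d * q, e * q, f * q, g, h * q] p)
    (hnsMinus : PhiNonsingular q (a / q ^ 2) ![b / q, c / q, d / q, e / q, f / q, g, h / q] p)
    (haq : a ≠ q) (hgh : h ≠ g * q) :
    a * g * q / h
        * (((1 - a * q) * (1 - a * q ^ 2)
            * (1 - a * q / (g * b)) * (1 - a * q / (g * c)) * (1 - a * q / (g * d))
            * (1 - a * q / (g * e)) * (1 - a * q / (g * f)))
          / ((1 - a * q / g) * (1 - a * q ^ 2 / g)
            * (1 - a * q / b) * (1 - a * q / c) * (1 - a * q / d)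
            * (1 - a * q / e) * (1 - a * q / f)))
        * (1 - g * h / (a * q)) * (1 - h)
        * (1 - b) * (1 - c) * (1 - d) * (1 - e) * (1 - f)
        * Phi q (a * q ^ 2) ![b * q, c * q, d * q, e * q, f * q, g, h * q] p
      - (q * (1 - a / g) * (1 - a * q / g) * (1 - a / h) * (1 - a * q / h)
            * (1 - a / b) * (1 - a / c) * (1 - a / d) * (1 - a / e) * (1 - a / f))
          / ((1 - a / q) * (1 - a))
        * Phi q (a / q ^ 2) ![b / q, c / q, d / q, e / q, f / q, g, h / q] p
      - (a * q / h * (1 - h / g) * (1 - g * h / (a * q))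
            * (1 - b) * (1 - c) * (1 - d) * (1 - e) * (1 - f)
          + g ^ 2 * q ^ 2 / h
            * (((1 - a * q / g) * (1 - a / h) * (1 - a * q / h) * (1 - h / q)
                * (1 - a / (g * b)) * (1 - a / (g * c)) * (1 - a / (g * d))
                * (1 - a / (g * e)) * (1 - a / (g * f)))
              / ((1 - g * q / h) * (1 - a / (g * q))))
          - (h * (1 - g) * (1 - a / g) * (1 - a * q / g)
              * (1 - a * q / (h * b)) * (1 - a * q / (h * c)) * (1 - a * q / (h * d))
              * (1 - a * q / (h * e)) * (1 - a * q / (h * f)))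
            / (1 - g * q / h))
        * Phi q a ![b, c, d, e, f, g, h] p
      = 0 := by
  have ha := hns.1
  have hx := hns.2.1
  have hb : b ≠ 0 := hx 0
  have hc : c ≠ 0 := hx 1
  have hd : d ≠ 0 := hx 2
  have he : e ≠ 0 := hx 3
  have hf : f ≠ 0 := hx 4
  have hg : g ≠ 0 := hx 5
  have hh : h ≠ 0 := hx 6
  set x : Fin 7 → ℂ := ![b, c, d, e, f, g, h] with hxdef
  have hplus : ![b * q, c * q, d * q, e * q, f * q, g, h * q] = scaleExcept q x 5 := by
    funext i; fin_cases i <;> rfl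
  have hminus : ![b / q, c / q, d / q, e / q, f / q, g, h / q] = scaleExcept q⁻¹ x 5 := by
    simp only [div_eq_mul_inv]
    funext i; fin_cases i <;> rfl
  have haq2 : a / q ^ 2 = a * q⁻¹ ^ 2 := by field_simp
  rw [hplus] at hnsPlus ⊢
  rw [hminus, haq2] at hnsMinus
  rw [hminus, haq2]
  have hprod : ∏ i, x i = a ^ 3 * q ^ 2 := by
    rw [← hbal, hxdef, Fin.prod_univ_seven]; rfl
  have hAq : 1 - a / q ≠ 0 := by
    rw [one_sub_div hq0]; exact div_ne_zero (sub_ne_zero.2 haq.symm) hq0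
  -- The lowered series has the denominator parameter (a/q²)q/g = a/(gq), and this is its leading
  -- factor.
  have hag : 1 - a / (g * q) ≠ 0 := by
    convert one_sub_mul_pow_ne_zero (hnsMinus.vwpRegular.2 5) 0 using 2
    rw [scaleExcept_self, show x 5 = g from rfl]; field_simp
  have hag' : g * q - a ≠ 0 := by
    rw [one_sub_div (mul_ne_zero hg hq0)] at hag
    exact (div_ne_zero_iff.1 hag).1
  have hden : ∀ i, 1 - a * q / x i ≠ 0 := fun i => by
    simpa using one_sub_mul_pow_ne_zero (hns.vwpRegular.2 i) 0
  have main := Phi_contiguous hq0 hq1 hprod hAq hns hnsPlus hnsMinus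
  have g8 : 1 - a * q ^ 2 / g ≠ 0 := by
    convert one_sub_mul_pow_ne_zero (hns.vwpRegular.2 5) 1 using 1
    rw [show x 5 = g from rfl]; ring
  exact eq_zero_of_mul_eq hag
    (raised_coeff_mul ha hq0 hb hc hd he hf hg hbal (hden 0) (hden 1) (hden 2) (hden 3) (hden 4)
      (hden 5) (hden 6) g8)
    (lowered_coeff_mul hq0 hns.vwpRegular.one_sub_ne_zero hAq)
    (middle_coeff_mul ha hq0 hx hbal hgh hag') main
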